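/- Let $\beta>1$ be a Pisot number, i.e. a real algebraic integer all of whose other conjugates have modulus $<1$. Let $T_\beta(x)=\beta x \bmod 1$, let $d_\beta(1)=(t_i)_{i\ge1}$, $t_i=\lfloor\beta T_\beta^{i-1}(1)\rfloor$; put $d^*_\beta(1)=(t_1\dots t_{n-1}(t_n-1))^\infty$ if $d_\beta(1)=t_1\dots t_n0^\infty$ with $t_n\ne0$ ($\beta$ is then called a simple Parry number), and $d^*_\beta(1)=d_\beta(1)$ otherwise. Let $X_\beta$ be the set of all $(y_i)_{i\in\mathbb Z}\in\{0,\dots,\lfloor\beta\rfloor\}^{\mathbb Z}$ with $(y_i)_{i\ge k}\le_{\mathrm{lex}}d^*_\beta(1)$ for all $k\in\mathbb Z$; write its elements as $(w,u)$ with $w=(y_{-i})_{i\ge0}$, $u=(y_i)_{i\ge1}$, and let $X^l_\beta$ be the set of all the $w$. Let $\mathcal M_\beta$ be the minimal automaton (without dead state) recognizing the set of finite factors of elements of $X_\beta$. Let $\mathbb K_\beta$ be the product of the completions of $\mathbb Q(\beta)$ at all its places $v$ (Archimedean and non-Archimedean) with $|\beta|_v<1$, let $\delta_\beta:\mathbb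 Q(\beta)\to\mathbb K_\beta$ be the diagonal embedding, $h_\beta$ the multiplication by $\delta_\beta(\beta)$ on $\mathbb K_\beta$, and set $\varphi_\beta(w)=\sum_{i\ge0}w_i\,\delta_\beta(\beta)^i$ and $\widetilde\varphi_\beta(w,u)=(-\varphi_\beta(w),\sum_{i\ge1}u_i\beta^{-i})$. Put $\mathcal R_\beta=\varphi_\beta(X^l_\beta)\subset\mathbb K_\beta$ and $\widetilde{\mathcal R}_\beta=\widetilde\varphi_\beta(X_\beta)\subset\mathbb K_\beta\times\mathbb R$. For a state $s$ of $\mathcal M_\beta$ let $\mathcal R_\beta(s)$ be the set of all $\varphi_\beta(w)$ where $w_0w_1w_2\dots$ is the label of an infinite path starting at $s$ in $\mathcal M_\beta$ with all arrows reversed. Then: 0. The number $d$ of states of $\mathcal M_\beta$ is finite; it is the period of $d^*_\beta(1)$ if $\beta$ is a simple Parry number, and the sum of the (minimal) preperiod and period of $d^*_\beta(1)$ otherwise. 1. $\mathcal R_\beta$ has a graph-directed self-affine structure with the $d$ pieces $\mathcal R_\beta(s)$: the pieces are non-empty and compact, $\mathcal R_\beta=\bigcup_s\mathcal R_\beta(s)$,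 and for every state $s$ $$\mathcal R_\beta(s)=\bigcup_{p\xrightarrow{a}s}\bigl(h_\beta(\mathcal R_\beta(p))+\delta_\beta(a)\bigr),$$ where the union is over the finitely many arrows of $\mathcal M_\beta$ that end in $s$ ($p$ is the origin and $a$ the label of the arrow), and the maps $x\mapsto h_\beta(x)+\delta_\beta(a)$ are contracting affine bijections (each coordinate is scaled by a factor in $(0,1)$). For the Haar measure of $\mathbb K_\beta$, the sets in this union are pairwise disjoint up to measure zero, the $d$ pieces $\mathcal R_\beta(s)$ are pairwise disjoint up to measure zero, and $\mathcal R_\beta$ and each of the pieces have positive measure. 2. $\widetilde{\mathcal R}_\beta$ has positive Haar measure in $\mathbb K_\beta\times\mathbb R$, and there are compact intervals $[a_s,b_s]\subset\mathbb R$ with $a_s<b_s$ such that $$\widetilde{\mathcal R}_\beta=\bigcup_s\bigl(-\mathcal R_\beta(s)\bigr)\times[a_s,b_s],$$ where the $d$ cylinders are pairwise disjoint up to measure zero. -/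

import Mathlib

open NumberField IsDedekindDomain MeasureTheory Filter
open scoped IntermediateField Pointwise

noncomputable section

namespace BetaShift

/-! ### Pisot numbers -/

/-- A Pisot number: a real algebraic integer `β > 1` all of whose other Galois conjugates have
modulus strictly smaller than `1`. -/
structure IsPisot (β : ℝ) : Prop where
  one_lt : 1 < β
  isIntegral : IsIntegral ℤ β
  norm_conjugate_lt : ∀ z : ℂ, Polynomial.aeval z (minpoly ℚ β) = 0 → z ≠ (β : ℂ) → ‖z‖ < 1

/-! ### Beta-expansions and the beta-shift -/

/-- The `β`-transformation `x ↦ β x mod 1`. -/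
def betaMap (β x : ℝ) : ℝ := Int.fract (β * x)

/-- The expansion `d_β(1) = t₁ t₂ …` of `1`; the index is shifted by one, so that
`betaOne β i = t_{i+1} = ⌊β T_β^i(1)⌋`. -/
def betaOne (β : ℝ) (i : ℕ) : ℕ := ⌊β * (betaMap β)^[i] 1⌋₊

/-- `β` is a simple Parry number: `d_β(1)` is finite, i.e. ends in zeros. -/
def IsSimpleParry (β : ℝ) : Prop := ∃ n, ∀ i, n ≤ i → betaOne β i = 0

/-- The length `n` of a finite expansion `d_β(1) = t₁ … t_n`, `t_n ≠ 0`. -/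
def betaOneLength (β : ℝ) : ℕ := sInf {n | ∀ i, n ≤ i → betaOne β i = 0}

open Classical in
/-- The sequence `d*_β(1)`: it is `(t₁ … t_{n-1} (t_n - 1))^∞` if `d_β(1) = t₁ … t_n` is finite,
and `d_β(1)` otherwise (again indexed from `0`). -/
def betaOneStar (β : ℝ) (i : ℕ) : ℕ :=
  if IsSimpleParry β then
    if i % betaOneLength β = betaOneLength β - 1 then betaOne β (betaOneLength β - 1) - 1
    else betaOne β (i % betaOneLength β)
  else betaOne β i

/-- The two-sided `β`-shift `X_β`: all `y : ℤ → {0, …, ⌊β⌋}` such that `(y_i)_{i ≥ k}` is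
lexicographically at most `d*_β(1)`, for every `k : ℤ`. -/
def twoSidedShift (β : ℝ) : Set (ℤ → ℕ) :=
  {y | (∀ i, y i ≤ ⌊β⌋₊) ∧ ∀ k : ℤ, toLex (fun n : ℕ => y (k + n)) ≤ toLex (betaOneStar β)}

/-- The past `w = (y_{-i})_{i ≥ 0}` of a two-sided sequence. -/
def past (y : ℤ → ℕ) (i : ℕ) : ℕ := y (-(i : ℤ))

/-- The left one-sided `β`-shift `X_β^l`. -/
def leftShift (β : ℝ) : Set (ℕ → ℕ) := past '' twoSidedShift β

/-- The language `F(X_β)` of the finite words that occur in some element of `X_β`. -/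
def factors (β : ℝ) : Language ℕ :=
  {l : List ℕ | ∃ y ∈ twoSidedShift β, ∃ k : ℤ,
    l = (List.range l.length).map fun j : ℕ => y (k + j)}

/-! ### The minimal automaton of the beta-shift -/

/-- The states of the minimal automaton `M_β` that recognizes `F(X_β)`: those of the Myhill-Nerode
automaton (the left quotients of the language), without the dead state, whose language is empty. -/
abbrev State (β : ℝ) : Type :=
  {q : Set.range (factors β).leftQuotient // (q : Language ℕ) ≠ 0}

/-- `Edge β p a q`: the automaton `M_β` has an arrow with label `a` from `p` to `q`. -/
def Edge (β : ℝ) (p : State β) (a : ℕ) (q : State β) : Prop :=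
  (factors β).toDFA.step p.1 a = q.1

/-- The shift on one-sided sequences. -/
def shiftSeq (s : ℕ → ℕ) (i : ℕ) : ℕ := s (i + 1)

/-- The length of the shortest preperiod of an ultimately periodic sequence. -/
def preperiod (s : ℕ → ℕ) : ℕ := sInf {n | shiftSeq^[n] s ∈ Function.periodicPts shiftSeq}

/-- The length of the shortest period of an ultimately periodic sequence. -/
def period (s : ℕ → ℕ) : ℕ := Function.minimalPeriod shiftSeq (shiftSeq^[preperiod s] s)

open Classical in
/-- The period of `d*_β(1)` if `β` is a simple Parry number, and the sum of its preperiod and its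
period otherwise. -/
def numPieces (β : ℝ) : ℕ :=
  if IsSimpleParry β then period (betaOneStar β)
  else preperiod (betaOneStar β) + period (betaOneStar β)

/-! ### The representation space -/

/-- The number field `ℚ(β)`. -/
abbrev QBeta (β : ℝ) : Type := ℚ⟮β⟯

instance instNumberFieldQBeta (β : ℝ) [hβ : Fact (IsPisot β)] : NumberField (QBeta β) where
  to_charZero := inferInstance
  to_finiteDimensional :=
    IntermediateField.adjoin.finiteDimensional (hβ.out.isIntegral.tower_top (A := ℚ))

/-- The element `β` of `ℚ(β)`. -/
abbrev gen (β : ℝ) : QBeta β := IntermediateField.AdjoinSimple.gen ℚ β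

section Space

variable (β : ℝ) [hβ : Fact (IsPisot β)]

/-- The Archimedean places of `ℚ(β)` at which `|β|_v < 1`: one for each real conjugate of `β` other
than `β`, and one for each pair of complex conjugates. -/
abbrev ArchPlace : Type := {v : InfinitePlace (QBeta β) // v (gen β) < 1}

/-- The non-zero prime ideals `I` of the ring of integers of `ℚ(β)` that contain `β`, i.e. those
with `|β|_I < 1`. -/
abbrev PrimePlace : Type :=
  {v : HeightOneSpectrum (𝓞 (QBeta β)) // v.valuation (QBeta β) (gen β) < 1}

/-- The representation space `K_β`: the product of the completions of `ℚ(β)` at all the places at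
which `|β|_v < 1`, with the product topology. -/
def RepSpace : Type :=
  (∀ v : ArchPlace β, v.1.Completion) × (∀ v : PrimePlace β, v.1.adicCompletion (QBeta β))

instance : CommRing (RepSpace β) :=
  inferInstanceAs (CommRing
    ((∀ v : ArchPlace β, v.1.Completion) × (∀ v : PrimePlace β, v.1.adicCompletion (QBeta β))))

instance : TopologicalSpace (RepSpace β) :=
  inferInstanceAs (TopologicalSpace
    ((∀ v : ArchPlace β, v.1.Completion) × (∀ v : PrimePlace β, v.1.adicCompletion (QBeta β))))

instance : IsTopologicalRing (RepSpace β) :=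
  inferInstanceAs (IsTopologicalRing
    ((∀ v : ArchPlace β, v.1.Completion) × (∀ v : PrimePlace β, v.1.adicCompletion (QBeta β))))

instance : T2Space (RepSpace β) :=
  inferInstanceAs (T2Space
    ((∀ v : ArchPlace β, v.1.Completion) × (∀ v : PrimePlace β, v.1.adicCompletion (QBeta β))))

instance : MeasurableSpace (RepSpace β) := borel _

instance : BorelSpace (RepSpace β) := ⟨rfl⟩

/-! `K_β` is locally compact, so that it carries a Haar measure. -/

theorem exists_close (v : HeightOneSpectrum (𝓞 (QBeta β))) (x : v.adicCompletion (QBeta β))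
    (hx : Valued.v x ≤ 1) : ∃ a : 𝓞 (QBeta β),
      Valued.v (x - algebraMap (QBeta β) (v.adicCompletion (QBeta β)) a) < 1 := by
  have hd := HeightOneSpectrum.denseRange_algebraMap (QBeta β) v
  have ho : IsOpen {y : v.adicCompletion (QBeta β) | ‖x - y‖ < 1} :=
    isOpen_lt (by fun_prop) continuous_const
  obtain ⟨k, hk⟩ := hd.exists_mem_open ho ⟨x, by simp⟩
  have hk' : Valued.v (x - algebraMap (QBeta β) (v.adicCompletion (QBeta β)) k) < 1 := by
    rw [Set.mem_ofPred_eq, FinitePlace.norm_def] at hk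
    exact (WithZeroMulInt.toNNReal_lt_one_iff
        (HeightOneSpectrum.one_lt_absNorm_nnreal v)).1 (by exact_mod_cast hk)
  have hk1 : Valued.v (algebraMap (QBeta β) (v.adicCompletion (QBeta β)) k) ≤ 1 := by
    have := Valuation.map_sub (Valued.v) x (x - algebraMap (QBeta β) (v.adicCompletion (QBeta β)) k)
    rw [sub_sub_cancel] at this
    exact this.trans (max_le hx hk'.le)
  have hk2 : v.valuation (QBeta β) k ≤ 1 :=
    (HeightOneSpectrum.valuedAdicCompletion_eq_valuation' v k).symm.trans_le hk1
  obtain ⟨a, ha⟩ := HeightOneSpectrum.exists_valuation_sub_lt_of_integer v hk2 1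
  refine ⟨a, ?_⟩
  have ha' : Valued.v (algebraMap (QBeta β) (v.adicCompletion (QBeta β)) (k - a)) < 1 := by
    refine (HeightOneSpectrum.valuedAdicCompletion_eq_valuation' v (k - a)).trans_lt ?_
    rw [Valuation.map_sub_swap]
    exact_mod_cast ha
  rw [map_sub] at ha'
  have := Valuation.map_add (Valued.v) _ _ |>.trans_lt (max_lt hk' ha')
  rwa [sub_add_sub_cancel] at this

open scoped Valued in
theorem properSpace_adicCompletion (v : HeightOneSpectrum (𝓞 (QBeta β))) :
    ProperSpace (v.adicCompletion (QBeta β)) := by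
  rw [Valued.integer.properSpace_iff_completeSpace_and_isDiscreteValuationRing_integer_and_finite_residueField]
  refine ⟨inferInstance,
    inferInstanceAs (IsDiscreteValuationRing (v.adicCompletionIntegers (QBeta β))), ?_⟩
  have : Finite (𝓞 (QBeta β) ⧸ v.asIdeal) := v.asIdeal.finiteQuotientOfFreeOfNeBot v.ne_bot
  have hle (a : 𝓞 (QBeta β)) :
      Valued.v (algebraMap (QBeta β) (v.adicCompletion (QBeta β)) a) ≤ 1 :=
    (HeightOneSpectrum.valuedAdicCompletion_eq_valuation' v _).trans_le (v.valuation_le_one a)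
  let f : 𝓞 (QBeta β) → 𝓀[v.adicCompletion (QBeta β)] := fun a =>
    IsLocalRing.residue _ (⟨_, hle a⟩ : 𝒪[v.adicCompletion (QBeta β)])
  have hf : Function.Surjective f := by
    intro z
    obtain ⟨x, rfl⟩ := IsLocalRing.residue_surjective z
    obtain ⟨a, ha⟩ := exists_close β v x.1 x.2
    refine ⟨a, ?_⟩
    rw [eq_comm, ← sub_eq_zero, ← map_sub, IsLocalRing.residue_eq_zero_iff,
      IsLocalRing.mem_maximalIdeal, mem_nonunits_iff, Valuation.Integer.not_isUnit_iff_valuation_lt_one]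
    exact ha
  refine Finite.of_surjective (fun q : 𝓞 (QBeta β) ⧸ v.asIdeal => f q.out) fun z => ?_
  obtain ⟨a, rfl⟩ := hf z
  refine ⟨Ideal.Quotient.mk _ a, ?_⟩
  rw [← sub_eq_zero, ← map_sub, IsLocalRing.residue_eq_zero_iff,
      IsLocalRing.mem_maximalIdeal, mem_nonunits_iff, Valuation.Integer.not_isUnit_iff_valuation_lt_one]
  have hq : (Ideal.Quotient.mk v.asIdeal a).out - a ∈ v.asIdeal := by
    rw [← Ideal.Quotient.eq]; exact Quotient.out_eq' _
  have := (HeightOneSpectrum.valuedAdicCompletion_eq_valuation' v _).trans_lt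
    ((v.valuation_lt_one_iff_mem (K := QBeta β) _).2 hq)
  change Valued.v (algebraMap (QBeta β) (v.adicCompletion (QBeta β)) _ -
    algebraMap (QBeta β) (v.adicCompletion (QBeta β)) _) < 1
  rw [← map_sub (algebraMap (QBeta β) (v.adicCompletion (QBeta β)))]
  exact this

instance : Finite (PrimePlace β) := by
  have h0 : gen β ≠ 0 := fun h => by
    have h1 : β = 0 := congrArg (algebraMap (QBeta β) ℝ) h
    have := hβ.out.one_lt
    linarith
  have hint : IsIntegral ℤ (gen β) :=
    (isIntegral_algebraMap_iff (algebraMap (QBeta β) ℝ).injective).1 hβ.out.isIntegral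
  let b : 𝓞 (QBeta β) := ⟨gen β, hint⟩
  have hb : b ≠ 0 := fun h => h0 (congrArg Subtype.val h)
  have hfin := Ideal.finite_factors (I := Ideal.span {b}) (by simpa using hb)
  refine Set.Finite.subset hfin fun v hv => ?_
  rw [Set.mem_ofPred_eq, Ideal.dvd_span_singleton]
  exact (v.valuation_lt_one_iff_mem (K := QBeta β) b).1 hv

instance : LocallyCompactSpace (RepSpace β) := by
  have := properSpace_adicCompletion β
  exact inferInstanceAs (LocallyCompactSpace
    ((∀ v : ArchPlace β, v.1.Completion) × (∀ v : PrimePlace β, v.1.adicCompletion (QBeta β))))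

/-- The canonical embedding `δ_β : ℚ(β) → K_β`. -/
def canonicalEmbedding : QBeta β →+* RepSpace β :=
  RingHom.prod (RingHom.pi fun v => algebraMap (QBeta β) v.1.Completion)
    (RingHom.pi fun v => algebraMap (QBeta β) (v.1.adicCompletion (QBeta β)))

/-- The affine map `x ↦ h_β(x) + δ_β(a)` of `K_β`, where `h_β` is the multiplication by
`δ_β(β)`. -/
def affineMap (a : ℕ) (x : RepSpace β) : RepSpace β :=
  canonicalEmbedding β (gen β) * x + canonicalEmbedding β (a : QBeta β)

/-! ### The representation maps and the Rauzy fractals -/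

/-- The one-sided representation map `φ_β(w) = ∑_{i ≥ 0} w_i δ_β(β)^i`. -/
def rep (w : ℕ → ℕ) : RepSpace β :=
  ∑' i, canonicalEmbedding β (w i : QBeta β) * canonicalEmbedding β (gen β) ^ i

theorem summable_mul_pow {F : Type*} [NormedField F] [CompleteSpace F] (c : ℕ → F) (x : F) (C : ℝ)
    (hc : ∀ i, ‖c i‖ ≤ C) (hx : ‖x‖ < 1) : Summable fun i => c i * x ^ i := by
  refine Summable.of_norm_bounded (g := fun i => C * ‖x‖ ^ i)
    ((summable_geometric_of_lt_one (norm_nonneg _) hx).mul_left C) fun i => ?_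
  rw [norm_mul, norm_pow]
  exact mul_le_mul_of_nonneg_right (hc i) (by positivity)

/-- The series that defines `φ_β` converges on `X_β^l`. -/
theorem summable_rep {w : ℕ → ℕ} (hw : w ∈ leftShift β) :
    Summable fun i => canonicalEmbedding β (w i : QBeta β) * canonicalEmbedding β (gen β) ^ i := by
  obtain ⟨y, hy, rfl⟩ := hw
  have hb : ∀ i, past y i ≤ ⌊β⌋₊ := fun i => hy.1 _
  have h1 : Summable fun i => (fun v : ArchPlace β => algebraMap (QBeta β) v.1.Completion (past y i) *
      algebraMap (QBeta β) v.1.Completion (gen β) ^ i) := by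
    refine Pi.summable.2 fun v => summable_mul_pow _ _ (⌊β⌋₊ : ℝ) (fun i => ?_) ?_
    · rw [map_natCast]
      exact (Nat.norm_cast_le _).trans (by simpa using hb i)
    · exact (InfinitePlace.Completion.norm_coe _ _).trans_lt v.2
  have h2 : Summable fun i => (fun v : PrimePlace β =>
      algebraMap (QBeta β) (v.1.adicCompletion (QBeta β)) (past y i) *
      algebraMap (QBeta β) (v.1.adicCompletion (QBeta β)) (gen β) ^ i) := by
    refine Pi.summable.2 fun v => summable_mul_pow _ _ (⌊β⌋₊ : ℝ) (fun i => ?_) ?_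
    · rw [map_natCast]
      exact (Nat.norm_cast_le _).trans (by simpa using hb i)
    · rw [FinitePlace.norm_def]
      have hv : Valued.v (algebraMap (QBeta β) (v.1.adicCompletion (QBeta β)) (gen β)) < 1 :=
        (HeightOneSpectrum.valuedAdicCompletion_eq_valuation' v.1 (gen β)).trans_lt v.2
      exact_mod_cast (WithZeroMulInt.toNNReal_lt_one_iff
        (HeightOneSpectrum.one_lt_absNorm_nnreal v.1)).2 hv
  exact (h1.hasSum.prodMk h2.hasSum).summable

/-- The Rauzy fractal `R_β = φ_β(X_β^l)` of the one-sided `β`-shift. -/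
def rauzy : Set (RepSpace β) := rep β '' leftShift β

/-- The piece of `R_β` at a state `s`: the image of all the label sequences `(w_k)_{k ≥ 0}` of
infinite paths that start at `s` in the automaton `M_β` with all its arrows reversed. -/
def rauzyPiece (s : State β) : Set (RepSpace β) :=
  {x | ∃ (w : ℕ → ℕ) (q : ℕ → State β), q 0 = s ∧ (∀ k, Edge β (q (k + 1)) (w k) (q k)) ∧
    x = rep β w}

/-- The two-sided representation map: `(w, u) ↦ (-φ_β(w), ∑_{i ≥ 1} u_i β^{-i})`, where
`w = (y_{-i})_{i ≥ 0}` and `u = (y_i)_{i ≥ 1}`. -/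
def rep₂ (y : ℤ → ℕ) : RepSpace β × ℝ :=
  (-rep β (past y), ∑' i : ℕ, (y (i + 1) : ℝ) * β⁻¹ ^ (i + 1))

/-- The Rauzy fractal of the two-sided `β`-shift. -/
def rauzy₂ : Set (RepSpace β × ℝ) := rep₂ β '' twoSidedShift β

/-! ### Graph-directed self-affine sets -/

/-- A contracting affine bijection of `K_β`: a translation after a multiplication by an element
that scales each coordinate by a factor strictly between `0` and `1`. -/
def IsAffineContraction (f : RepSpace β → RepSpace β) : Prop :=
  ∃ a b : RepSpace β, (∀ v, 0 < ‖a.1 v‖ ∧ ‖a.1 v‖ < 1) ∧ (∀ v, 0 < ‖a.2 v‖ ∧ ‖a.2 v‖ < 1) ∧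
    ∀ x, f x = a * x + b

/-- The set `A` has a graph-directed self-affine structure with vertex set `V`, edge set `E`
(`e : E` goes from `src e` to `tgt e`), affine contractions `T e` and pieces `P v`, all of whose
overlaps are negligible for `μ`. -/
structure IsGraphDirectedSelfAffine (μ : Measure (RepSpace β)) {V E : Type} (src tgt : E → V)
    (T : E → RepSpace β → RepSpace β) (P : V → Set (RepSpace β)) (A : Set (RepSpace β)) :
    Prop where
  finite_vertices : Finite V
  finite_edges : Finite E
  contraction : ∀ e, IsAffineContraction β (T e)
  isCompact : ∀ v, IsCompact (P v)
  nonempty : ∀ v, (P v).Nonempty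
  iUnion_eq : A = ⋃ v, P v
  piece_eq : ∀ v, P v = ⋃ e : {e : E // src e = v}, T e.1 '' P (tgt e.1)
  aedisjoint_image : ∀ v, Pairwise fun e e' : {e : E // src e = v} =>
    AEDisjoint μ (T e.1 '' P (tgt e.1)) (T e'.1 '' P (tgt e'.1))
  aedisjoint_piece : Pairwise fun v v' => AEDisjoint μ (P v) (P v')

/-- The arrows `(p, a, q)` of the minimal automaton `M_β`. -/
abbrev Arrow : Type := {e : State β × ℕ × State β // Edge β e.1 e.2.1 e.2.2}

end Space

end BetaShift

end

open BetaShift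

noncomputable section

namespace BetaShift

section

/-! ### The quasi-greedy expansion of `1` -/

/-! The states of `M_β` can be replaced by real numbers. On `(0, 1]` let a letter `a` be readable
from `u` if `0 < βu - a`, leading to `min 1 (βu - a)`. Any digit below the largest readable one
resets the state to `1`, and the largest one applies the quasi-greedy map, whose digits along the
orbit of `1` are `d*_β(1)`. Hence the words readable from `1` are the factors of `X_β`
(`mem_factors_iff`). Distinct numbers have distinct follower languages (`not_lt_of_adm`), so the
states correspond to the quasi-greedy orbit of `1` (`stateEquiv`). For a Pisot number this orbit
consists of algebraic integers of `ℚ(β)` with bounded conjugates, so it is finite, and its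
cardinality is preperiod plus period.

The set equation for the pieces comes from removing the first arrow of a backward path, and
compactness from the finiteness of the alphabet and of the state set. The sums of the futures
readable from a state `s` fill `[0, s.val]`, which gives the cylinders of the two-sided fractal.

The measure statements rest on the fact that multiplication by `δ_β(β)` scales Haar measure by
exactly `1/β`. The bound from below compares the index of `(β)`, which is `|N(β)|`, with the product
of the absolute values of `β` at the Archimedean places. The bound from above is a packing argument:
at least `βⁿ` integers have greedy expansions of length `n`, their images lie in the compact set
`R_β`, and translates of the `n`-fold contracted small box centred at them are disjoint
(`eq_zero_of_mem_smallBox`). Once the factor is known, the same packing gives `μ(R_β + βⁿ · box) ≥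
μ(box)` for all `n`, hence positive measure.

Finally `State.val` is an eigenvector of the automaton for the eigenvalue `β` (`sum_stateStep`).
Pairing it with the measures of the pieces forces equality in the subadditivity of each set
equation, so the overlaps are null. Distinct pieces are separated by reading zeros until their
states merge, and positivity spreads from one piece to all others along arrows. -/

/-- The quasi-greedy `β`-transformation of `(0, 1]`. -/
def qgMap (β u : ℝ) : ℝ := β * u - ⌈β * u⌉ + 1

/-- The quasi-greedy digit of `u`. -/
def qgDigit (β u : ℝ) : ℕ := ⌈β * u⌉₊ - 1

/-- The orbit of `1` under the quasi-greedy transformation. -/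
def qgOrbit (β : ℝ) (k : ℕ) : ℝ := (qgMap β)^[k] 1

theorem qgMap_pos (β u : ℝ) : 0 < qgMap β u := by
  have := Int.ceil_lt_add_one (β * u)
  unfold qgMap; linarith

theorem qgMap_le_one (β u : ℝ) : qgMap β u ≤ 1 := by
  have := Int.le_ceil (β * u)
  unfold qgMap; linarith

@[simp] theorem qgOrbit_zero (β : ℝ) : qgOrbit β 0 = 1 := rfl

theorem qgOrbit_succ (β : ℝ) (k : ℕ) : qgOrbit β (k + 1) = qgMap β (qgOrbit β k) :=
  Function.iterate_succ_apply' _ _ _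

theorem qgOrbit_pos (β : ℝ) (k : ℕ) : 0 < qgOrbit β k := by
  cases k with
  | zero => simp
  | succ k => rw [qgOrbit_succ]; exact qgMap_pos _ _

theorem qgOrbit_le_one (β : ℝ) (k : ℕ) : qgOrbit β k ≤ 1 := by
  cases k with
  | zero => simp
  | succ k => rw [qgOrbit_succ]; exact qgMap_le_one _ _

theorem qgDigit_cast {β u : ℝ} (hβ : 0 < β) (hu : 0 < u) : (qgDigit β u : ℝ) = ⌈β * u⌉ - 1 := by
  have h : 0 < β * u := mul_pos hβ hu
  have h1 : 1 ≤ ⌈β * u⌉₊ := Nat.one_le_iff_ne_zero.2 (Nat.ceil_pos.2 h).ne'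
  rw [qgDigit, Nat.cast_sub h1, natCast_ceil_eq_intCast_ceil h.le, Nat.cast_one]

theorem qgMap_eq {β u : ℝ} (hβ : 0 < β) (hu : 0 < u) : qgMap β u = β * u - qgDigit β u := by
  rw [qgDigit_cast hβ hu, qgMap]; ring

/-- The digits that are possible at `u` are those up to the quasi-greedy one. -/
theorem le_qgDigit_iff {β u : ℝ} (hβ : 0 < β) (hu : 0 < u) (a : ℕ) :
    a ≤ qgDigit β u ↔ 0 < β * u - a := by
  have h : 0 < β * u := mul_pos hβ hu
  have h1 : 0 < ⌈β * u⌉₊ := Nat.ceil_pos.2 h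
  rw [sub_pos, ← Nat.lt_ceil, qgDigit]
  omega

/-! ### Comparison of the greedy and quasi-greedy expansions. -/

theorem betaMap_nonneg (β x : ℝ) : 0 ≤ betaMap β x := Int.fract_nonneg _

theorem betaMap_lt_one (β x : ℝ) : betaMap β x < 1 := Int.fract_lt_one _

theorem betaMap_eq {β x : ℝ} (hβ : 0 < β) (hx : 0 ≤ x) :
    betaMap β x = β * x - (⌊β * x⌋₊ : ℝ) := by
  rw [natCast_floor_eq_intCast_floor (mul_nonneg hβ.le hx)]; rfl

theorem iterate_betaMap_nonneg (β : ℝ) (k : ℕ) : 0 ≤ (betaMap β)^[k] 1 := by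
  cases k with
  | zero => simp
  | succ k => rw [Function.iterate_succ_apply']; exact betaMap_nonneg _ _

theorem ceil_eq_floor_add_one {x : ℝ} (h : Int.fract x ≠ 0) : ⌈x⌉ = ⌊x⌋ + 1 :=
  Int.ceil_eq_floor_add_one_iff_notMem x |>.2 fun ⟨n, hn⟩ => h (by rw [← hn, Int.fract_intCast])

theorem qgMap_eq_betaMap {β x : ℝ} (h : betaMap β x ≠ 0) : qgMap β x = betaMap β x := by
  rw [qgMap, betaMap, ceil_eq_floor_add_one h, Int.fract]; push_cast; ring

theorem qgMap_eq_one {β x : ℝ} (h : betaMap β x = 0) : qgMap β x = 1 := by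
  obtain ⟨n, hn⟩ := Int.fract_eq_zero_iff.1 h
  rw [qgMap, ← hn, Int.ceil_intCast]; ring

theorem qgDigit_eq_of_ne {β x : ℝ} (hβ : 0 < β) (hx : 0 < x) (h : betaMap β x ≠ 0) :
    qgDigit β x = ⌊β * x⌋₊ := by
  have h1 := qgMap_eq hβ hx
  rw [qgMap_eq_betaMap h, betaMap_eq hβ hx.le] at h1
  exact_mod_cast (by linarith : (qgDigit β x : ℝ) = ⌊β * x⌋₊)

theorem qgDigit_eq_of_eq {β x : ℝ} (hβ : 0 < β) (hx : 0 < x) (h : betaMap β x = 0) :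
    qgDigit β x = ⌊β * x⌋₊ - 1 := by
  have h1 := qgMap_eq hβ hx
  rw [betaMap_eq hβ hx.le] at h
  rw [qgMap_eq_one (by rw [betaMap_eq hβ hx.le, h])] at h1
  have : (qgDigit β x : ℝ) + 1 = ⌊β * x⌋₊ := by linarith
  have : qgDigit β x + 1 = ⌊β * x⌋₊ := by exact_mod_cast this
  omega

theorem iterate_betaMap_eq_zero {β : ℝ} {n : ℕ} (h : (betaMap β)^[n] 1 = 0) {i : ℕ} (hi : n ≤ i) :
    (betaMap β)^[i] 1 = 0 := by
  induction i, hi using Nat.le_induction with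
  | base => exact h
  | succ i _ ih => rw [Function.iterate_succ_apply', ih]; simp [betaMap]

theorem betaOne_eq_zero {β : ℝ} {n : ℕ} (h : (betaMap β)^[n] 1 = 0) {i : ℕ} (hi : n ≤ i) :
    betaOne β i = 0 := by
  rw [betaOne, iterate_betaMap_eq_zero h hi]; simp

/-- When all further digits vanish, the iterates are only multiplied by `β`; a positive one would
eventually leave `[0, 1)`. -/
theorem iterate_betaMap_eq_zero_of_betaOne {β : ℝ} (hβ : 1 < β) {n : ℕ}
    (h : ∀ i, n ≤ i → betaOne β i = 0) : (betaMap β)^[n] 1 = 0 := by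
  have h1 : ∀ j, (betaMap β)^[n + j] 1 = β ^ j * (betaMap β)^[n] 1 := by
    intro j
    induction j with
    | zero => simp
    | succ j ih =>
      have h2 := betaMap_eq (by linarith) (iterate_betaMap_nonneg β (n + j)) (β := β)
      have h3 := h (n + j) (by omega)
      rw [betaOne] at h3
      rw [← Nat.add_assoc, Function.iterate_succ_apply', h2, h3, ih]
      simp [pow_succ']; ring
  by_contra hne
  have hpos := (iterate_betaMap_nonneg β n).lt_of_ne' hne
  obtain ⟨j, hj⟩ := pow_unbounded_of_one_lt ((betaMap β)^[n] 1)⁻¹ hβ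
  have h2 := h1 (j + 1)
  rw [← Nat.add_assoc, Function.iterate_succ_apply'] at h2
  have h3 := betaMap_lt_one β ((betaMap β)^[n + j] 1)
  have h4 : 1 < β ^ j * (betaMap β)^[n] 1 := by
    rwa [inv_lt_iff_one_lt_mul₀ hpos] at hj
  rw [pow_succ'] at h2
  nlinarith

theorem one_le_betaOne_zero {β : ℝ} (hβ : 1 < β) : 1 ≤ betaOne β 0 := by
  simpa [betaOne, Nat.one_le_floor_iff] using hβ.le

section Simple

variable {β : ℝ}

theorem betaOne_eq_zero_of_length_le (h : IsSimpleParry β) {i : ℕ} (hi : betaOneLength β ≤ i) :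
    betaOne β i = 0 := (Nat.sInf_mem h : betaOneLength β ∈ _) i hi

theorem betaOneLength_pos (hβ : 1 < β) (h : IsSimpleParry β) : 0 < betaOneLength β := by
  by_contra h0
  have := betaOne_eq_zero_of_length_le h (i := 0) (by omega)
  have := one_le_betaOne_zero hβ
  omega

theorem iterate_betaMap_ne_zero {k : ℕ} (hk : k < betaOneLength β) : (betaMap β)^[k] 1 ≠ 0 := by
  intro h
  exact Nat.notMem_of_lt_sInf hk fun i hi => betaOne_eq_zero h hi

/-- The two maps differ only where `βx` is an integer, that is, where the greedy orbit hits `0`. -/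
theorem qgOrbit_eq_iterate {n : ℕ} (h : ∀ k ≤ n, (betaMap β)^[k] 1 ≠ 0) :
    qgOrbit β n = (betaMap β)^[n] 1 := by
  induction n with
  | zero => simp
  | succ n ih =>
    have h1 := h (n + 1) le_rfl
    rw [Function.iterate_succ_apply'] at h1 ⊢
    rw [qgOrbit_succ, ih fun k hk => h k (by omega), qgMap_eq_betaMap h1]

/-- At the first time the greedy orbit hits `0` the quasi-greedy one returns to `1`; this is the
source of the period of `d*_β(1)`. -/
theorem qgOrbit_betaOneLength (hβ : 1 < β) (h : IsSimpleParry β) :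
    qgOrbit β (betaOneLength β) = 1 := by
  obtain ⟨n, hn⟩ := Nat.exists_eq_succ_of_ne_zero (betaOneLength_pos hβ h).ne'
  have h0 := iterate_betaMap_eq_zero_of_betaOne hβ fun i => betaOne_eq_zero_of_length_le h (i := i)
  rw [hn, Function.iterate_succ_apply'] at h0
  rw [hn, Nat.succ_eq_add_one, qgOrbit_succ,
    qgOrbit_eq_iterate fun k hk => iterate_betaMap_ne_zero (by omega), qgMap_eq_one h0]

theorem qgOrbit_mod (hβ : 1 < β) (h : IsSimpleParry β) (i : ℕ) :
    qgOrbit β (i % betaOneLength β) = qgOrbit β i := by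
  have hp : Function.IsPeriodicPt (qgMap β) (betaOneLength β) 1 := qgOrbit_betaOneLength hβ h
  exact hp.iterate_mod_apply i

/-- `d*_β(1)` is the quasi-greedy expansion of `1`. -/
theorem betaOneStar_eq (hβ : 1 < β) (i : ℕ) : betaOneStar β i = qgDigit β (qgOrbit β i) := by
  have hβ0 : 0 < β := by linarith
  by_cases hs : IsSimpleParry β
  · have hpos := betaOneLength_pos hβ hs
    rw [betaOneStar, if_pos hs, ← qgOrbit_mod hβ hs]
    have hlt := Nat.mod_lt i hpos
    set k := i % betaOneLength β
    have hk := qgOrbit_eq_iterate fun j (hj : j ≤ k) => iterate_betaMap_ne_zero (β := β) (by omega)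
    have hk0 := qgOrbit_pos β k
    split_ifs with h1
    -- Last place of the period: `βx` is an integer, and the quasi-greedy digit is one less than the
    -- greedy one.
    · rw [← h1, qgDigit_eq_of_eq hβ0 hk0, hk, betaOne]
      have h0 := iterate_betaMap_eq_zero_of_betaOne hβ
        fun i => betaOne_eq_zero_of_length_le hs (i := i)
      rwa [hk, ← Function.iterate_succ_apply' (betaMap β), h1, Nat.succ_eq_add_one,
        Nat.sub_add_cancel hpos]
    · rw [qgDigit_eq_of_ne hβ0 hk0, hk, betaOne]
      rw [hk, ← Function.iterate_succ_apply' (betaMap β)]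
      exact iterate_betaMap_ne_zero (by omega)
  · have hne : ∀ k, (betaMap β)^[k] 1 ≠ 0 := fun k hk => hs ⟨k, fun i hi => betaOne_eq_zero hk hi⟩
    rw [betaOneStar, if_neg hs, qgDigit_eq_of_ne hβ0 (qgOrbit_pos β i),
      qgOrbit_eq_iterate fun k _ => hne k, betaOne]
    rw [qgOrbit_eq_iterate fun k _ => hne k, ← Function.iterate_succ_apply' (betaMap β)]
    exact hne _

theorem iterate_shiftSeq (s : ℕ → ℕ) (n i : ℕ) : shiftSeq^[n] s i = s (i + n) := by
  induction n generalizing i with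
  | zero => rfl
  | succ n ih => rw [Function.iterate_succ_apply', shiftSeq, ih]; congr 1; omega

theorem betaOneStar_mem_periodicPts (hβ : 1 < β) (h : IsSimpleParry β) :
    betaOneStar β ∈ Function.periodicPts shiftSeq := by
  refine ⟨betaOneLength β, betaOneLength_pos hβ h, funext fun i => ?_⟩
  rw [iterate_shiftSeq, betaOneStar_eq hβ, betaOneStar_eq hβ, ← qgOrbit_mod hβ h,
    Nat.add_mod_right, qgOrbit_mod hβ h]

theorem preperiod_betaOneStar (hβ : 1 < β) (h : IsSimpleParry β) :
    preperiod (betaOneStar β) = 0 :=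
  Nat.sInf_eq_zero.2 (.inl (betaOneStar_mem_periodicPts hβ h))

theorem numPieces_eq (hβ : 1 < β) :
    numPieces β = preperiod (betaOneStar β) + period (betaOneStar β) := by
  unfold numPieces
  split_ifs with h
  · rw [preperiod_betaOneStar hβ h, zero_add]
  · rfl

end Simple

/-- Points that differ have quasi-greedy expansions that differ. -/
theorem eq_of_qgDigit_eq {β u v : ℝ} (hβ : 1 < β) (hu : 0 < u) (hv : 0 < v)
    (h : ∀ i, qgDigit β ((qgMap β)^[i] u) = qgDigit β ((qgMap β)^[i] v)) : u = v := by
  have hpos : ∀ w : ℝ, 0 < w → ∀ i, 0 < (qgMap β)^[i] w := by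
    intro w hw i
    cases i with
    | zero => simpa
    | succ i => rw [Function.iterate_succ_apply']; exact qgMap_pos _ _
  -- With equal digits the difference is multiplied by `β` at each step, yet it stays below `1`
  -- because the iterates lie in `(0, 1]`.
  have key : ∀ i, (qgMap β)^[i] u - (qgMap β)^[i] v = β ^ i * (u - v) := by
    intro i
    induction i with
    | zero => simp
    | succ i ih =>
      rw [Function.iterate_succ_apply', Function.iterate_succ_apply',
        qgMap_eq (by linarith) (hpos u hu i), qgMap_eq (by linarith) (hpos v hv i), h i, pow_succ',
        mul_assoc, ← ih]
      ring
  by_contra hne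
  have hd : 0 < |u - v| := abs_pos.2 (sub_ne_zero.2 hne)
  obtain ⟨j, hj⟩ := pow_unbounded_of_one_lt (|u - v|)⁻¹ hβ
  rw [inv_lt_iff_one_lt_mul₀ hd] at hj
  have h1 := key (j + 1)
  have h2 : |(qgMap β)^[j + 1] u - (qgMap β)^[j + 1] v| < 1 := by
    rw [Function.iterate_succ_apply', Function.iterate_succ_apply', abs_sub_lt_iff]
    constructor <;>
      linarith [qgMap_pos β ((qgMap β)^[j] u), qgMap_pos β ((qgMap β)^[j] v),
        qgMap_le_one β ((qgMap β)^[j] u), qgMap_le_one β ((qgMap β)^[j] v)]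
  rw [h1, abs_mul, abs_of_pos (by positivity), pow_succ'] at h2
  nlinarith

theorem iterate_shiftSeq_betaOneStar_eq_iff {β : ℝ} (hβ : 1 < β) (k l : ℕ) :
    shiftSeq^[k] (betaOneStar β) = shiftSeq^[l] (betaOneStar β) ↔
      qgOrbit β k = qgOrbit β l := by
  have h : ∀ k i, shiftSeq^[k] (betaOneStar β) i = qgDigit β ((qgMap β)^[i] (qgOrbit β k)) := by
    intro k i
    rw [iterate_shiftSeq, betaOneStar_eq hβ, qgOrbit, qgOrbit, Function.iterate_add_apply]
  refine ⟨fun hkl => eq_of_qgDigit_eq hβ (qgOrbit_pos β k) (qgOrbit_pos β l) fun i => ?_,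
    fun hkl => funext fun i => ?_⟩
  · rw [← h, ← h, hkl]
  · rw [h, h, hkl]

/-! ### Counting the points of an orbit -/

/-- An eventually periodic orbit has the shape of the letter ρ: the tail, of preperiod length, and
the cycle, of period length, contain no repetition. -/
theorem card_range_iterate {α : Type*} (f : α → α) (x : α)
    (hfin : (Set.range fun k => f^[k] x).Finite) :
    Nat.card (Set.range fun k => f^[k] x) = sInf {n | f^[n] x ∈ Function.periodicPts f} +
      Function.minimalPeriod f (f^[sInf {n | f^[n] x ∈ Function.periodicPts f}] x) := by
  have hne : {n | f^[n] x ∈ Function.periodicPts f}.Nonempty := by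
    have : ¬ Function.Injective fun k => f^[k] x := fun hinj =>
      Set.infinite_range_of_injective hinj hfin
    simp only [Function.Injective, not_forall] at this
    obtain ⟨a, b, hab, hne⟩ := this
    wlog hlt : a < b generalizing a b
    · exact this b a hab.symm (Ne.symm hne) (by omega)
    refine ⟨a, b - a, by omega, ?_⟩
    change f^[b - a] (f^[a] x) = f^[a] x
    rw [← Function.iterate_add_apply, Nat.sub_add_cancel hlt.le]
    exact hab.symm
  set n := sInf {n | f^[n] x ∈ Function.periodicPts f} with hn
  have hnp : f^[n] x ∈ Function.periodicPts f := Nat.sInf_mem hne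
  set y := f^[n] x with hy
  set p := Function.minimalPeriod f y with hp
  have hp0 : 0 < p := Function.minimalPeriod_pos_of_mem_periodicPts hnp
  have hadd : ∀ i, f^[n + i] x = f^[i] y := fun i => by
    rw [hy, ← Function.iterate_add_apply, Nat.add_comm]
  have hinj : Set.InjOn (fun k => f^[k] x) (Finset.range (n + p)) := by
    intro a ha b hb hab
    wlog hlt : a ≤ b generalizing a b
    · exact (this hb ha hab.symm (by omega)).symm
    have ha' : a < n + p := by simpa using ha
    have hb' : b < n + p := by simpa using hb
    simp only at hab
    by_contra hne
    by_cases han : n ≤ a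
    · obtain ⟨i, rfl⟩ := Nat.exists_eq_add_of_le han
      obtain ⟨j, rfl⟩ := Nat.exists_eq_add_of_le (han.trans hlt)
      rw [hadd, hadd] at hab
      have := Function.iterate_injOn_Iio_minimalPeriod (f := f) (x := y)
        (Set.mem_Iio.2 (by omega : i < p)) (Set.mem_Iio.2 (by omega : j < p)) hab
      omega
    -- A repetition involving a point of the tail would make that point periodic, against the
    -- minimality of `n`.
    · have : a ∈ {n | f^[n] x ∈ Function.periodicPts f} := by
        refine ⟨b - a, by omega, ?_⟩
        change f^[b - a] (f^[a] x) = f^[a] x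
        rw [← Function.iterate_add_apply, Nat.sub_add_cancel hlt]
        exact hab.symm
      exact han (Nat.sInf_le this)
  have hrange : (Set.range fun k => f^[k] x) = (fun k => f^[k] x) '' (Finset.range (n + p)) := by
    refine Set.Subset.antisymm ?_ (Set.image_subset_range _ _)
    rintro _ ⟨k, rfl⟩
    by_cases hk : k < n
    · exact ⟨k, by simp; omega, rfl⟩
    · obtain ⟨i, rfl⟩ := Nat.exists_eq_add_of_le (not_lt.1 hk)
      refine ⟨n + i % p, by simpa using Nat.mod_lt i hp0, ?_⟩
      simp only [hadd]
      exact (Function.isPeriodicPt_minimalPeriod f y).iterate_mod_apply i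
  rw [hrange, Nat.card_image_of_injOn hinj]
  simp

theorem card_range_qgOrbit {β : ℝ} (hβ : 1 < β) (hfin : (Set.range (qgOrbit β)).Finite) :
    Nat.card (Set.range (qgOrbit β)) = numPieces β := by
  have e : Set.range (qgOrbit β) ≃ Set.range fun k => shiftSeq^[k] (betaOneStar β) := by
    refine Equiv.ofBijective (fun u => ⟨shiftSeq^[u.2.choose] (betaOneStar β), _, rfl⟩) ⟨?_, ?_⟩
    · intro u v huv
      have := (iterate_shiftSeq_betaOneStar_eq_iff hβ _ _).1 (congrArg Subtype.val huv)
      rw [u.2.choose_spec, v.2.choose_spec] at this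
      exact Subtype.ext this
    · rintro ⟨_, k, rfl⟩
      let u : Set.range (qgOrbit β) := ⟨qgOrbit β k, k, rfl⟩
      exact ⟨u, Subtype.ext ((iterate_shiftSeq_betaOneStar_eq_iff hβ _ _).2 u.2.choose_spec)⟩
  have : Finite (Set.range (qgOrbit β)) := hfin
  have hfin' : (Set.range fun k => shiftSeq^[k] (betaOneStar β)).Finite :=
    have := Finite.of_equiv _ e
    Set.toFinite _
  rw [Nat.card_congr e, card_range_iterate shiftSeq _ hfin', numPieces_eq hβ]
  rfl

end

section

/-! ### Runs of the automaton on real states -/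

/-- The transition with label `a` from `u`; it is admissible if `0 < β * u - a`. -/
def stateStep (β u : ℝ) (a : ℕ) : ℝ := min 1 (β * u - a)

/-- The states visited when the sequence `f` is read from `u`. -/
def runFrom (β u : ℝ) (f : ℕ → ℕ) : ℕ → ℝ
  | 0 => u
  | n + 1 => stateStep β (runFrom β u f n) (f n)

/-- The word `l` can be read from `u`. -/
def Adm (β : ℝ) : ℝ → List ℕ → Prop
  | _, [] => True
  | u, a :: l => 0 < β * u - a ∧ Adm β (stateStep β u a) l

variable {β : ℝ}

theorem stateStep_le_one (β u : ℝ) (a : ℕ) : stateStep β u a ≤ 1 := min_le_left _ _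

theorem stateStep_le (β u : ℝ) (a : ℕ) : stateStep β u a ≤ β * u - a := min_le_right _ _

theorem stateStep_pos_iff {u : ℝ} {a : ℕ} : 0 < stateStep β u a ↔ 0 < β * u - a := by
  simp [stateStep]

theorem stateStep_qgDigit (hβ : 0 < β) {u : ℝ} (hu : 0 < u) :
    stateStep β u (qgDigit β u) = qgMap β u := by
  rw [stateStep, ← qgMap_eq hβ hu, min_eq_right (qgMap_le_one _ _)]

/-- If a larger digit was still possible, more than `1` unit is left over after reading `a`. The
lexicographic comparison is then decided, and the future is as free as from the state `1`. -/
theorem stateStep_of_lt (hβ : 0 < β) {u : ℝ} (hu : 0 < u) {a : ℕ} (ha : a < qgDigit β u) :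
    stateStep β u a = 1 := by
  have h1 := (le_qgDigit_iff hβ hu (a + 1)).1 ha
  push_cast at h1
  exact min_eq_left (by linarith)

theorem stateStep_mem_range (hβ : 0 < β) {u : ℝ} (hu : u ∈ Set.range (qgOrbit β)) {a : ℕ}
    (ha : 0 < β * u - a) : stateStep β u a ∈ Set.range (qgOrbit β) := by
  obtain ⟨k, rfl⟩ := hu
  have h0 := qgOrbit_pos β k
  rcases ((le_qgDigit_iff hβ h0 a).2 ha).lt_or_eq with h | rfl
  · exact ⟨0, (stateStep_of_lt hβ h0 h).symm⟩
  · exact ⟨k + 1, by rw [stateStep_qgDigit hβ h0, qgOrbit_succ]⟩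

theorem pos_of_mem_range {u : ℝ} (hu : u ∈ Set.range (qgOrbit β)) : 0 < u := by
  obtain ⟨k, rfl⟩ := hu
  exact qgOrbit_pos β k

theorem le_one_of_mem_range {u : ℝ} (hu : u ∈ Set.range (qgOrbit β)) : u ≤ 1 := by
  obtain ⟨k, rfl⟩ := hu
  exact qgOrbit_le_one β k

theorem adm_append (u : ℝ) (l l' : List ℕ) :
    Adm β u (l ++ l') ↔ Adm β u l ∧ Adm β (l.foldl (stateStep β) u) l' := by
  induction l generalizing u with
  | nil => simp [Adm]
  | cons a l ih => simp [Adm, ih, and_assoc]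

theorem foldl_range (u : ℝ) (f : ℕ → ℕ) (n : ℕ) :
    ((List.range n).map f).foldl (stateStep β) u = runFrom β u f n := by
  induction n with
  | zero => rfl
  | succ n ih => rw [List.range_succ, List.map_append, List.foldl_append, ih]; rfl

theorem adm_range_iff (u : ℝ) (f : ℕ → ℕ) (n : ℕ) :
    Adm β u ((List.range n).map f) ↔ ∀ j < n, 0 < β * runFrom β u f j - f j := by
  induction n with
  | zero => simp [Adm]
  | succ n ih =>
    rw [List.range_succ, List.map_append, adm_append, ih, foldl_range]
    simp only [List.map_cons, List.map_nil, Adm, and_true]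
    exact ⟨fun h j hj => (Nat.lt_succ_iff_lt_or_eq.1 hj).elim (h.1 j) fun e => e ▸ h.2,
      fun h => ⟨fun j hj => h j (by omega), h n (by omega)⟩⟩

theorem foldl_mem_range (hβ : 0 < β) {u : ℝ} (hu : u ∈ Set.range (qgOrbit β)) {l : List ℕ}
    (hl : Adm β u l) : l.foldl (stateStep β) u ∈ Set.range (qgOrbit β) := by
  induction l generalizing u with
  | nil => exact hu
  | cons a l ih => exact ih (stateStep_mem_range hβ hu hl.1) hl.2

theorem runFrom_mem_range (hβ : 0 < β) {u : ℝ} (hu : u ∈ Set.range (qgOrbit β)) {f : ℕ → ℕ}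
    (n : ℕ) (hf : ∀ j < n, 0 < β * runFrom β u f j - f j) :
    runFrom β u f n ∈ Set.range (qgOrbit β) := by
  rw [← foldl_range]
  exact foldl_mem_range hβ hu ((adm_range_iff u f n).2 hf)

theorem one_mem_range (β : ℝ) : (1 : ℝ) ∈ Set.range (qgOrbit β) := ⟨0, rfl⟩

theorem map_range_getD (l : List ℕ) : (List.range l.length).map (fun n => l.getD n 0) = l := by
  refine List.ext_getElem (by simp) fun n h1 h2 => ?_
  simp [List.getD_eq_getElem?_getD, h2]

/-! ### Elements of the two-sided shift -/

/-- The number `s k` is the state before `y (k + 1)` is read. If a tail exceeded `d*_β(1)`, the run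
would stay below the quasi-greedy orbit up to the first difference, where the larger digit could not
be read. An inequality in `h` suffices, which leaves freedom in the choice of `s`. -/
theorem mem_twoSidedShift_of_run (hβ : 1 < β) {y : ℤ → ℕ} {s : ℤ → ℝ} (hs : ∀ k, 0 < s k)
    (hs1 : ∀ k, s k ≤ 1) (h : ∀ k, s (k + 1) ≤ β * s k - y (k + 1)) : y ∈ twoSidedShift β := by
  have hβ0 : 0 < β := by linarith
  refine ⟨fun i => Nat.le_floor ?_, fun k => ?_⟩
  · have h1 := h (i - 1)
    rw [sub_add_cancel] at h1
    have h2 := hs i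
    have h3 := mul_le_mul_of_nonneg_left (hs1 (i - 1)) hβ0.le
    linarith
  · by_contra hlt
    rw [not_le] at hlt
    obtain ⟨j, hj, hj'⟩ := hlt
    change ∀ i < j, betaOneStar β i = y (k + i) at hj
    change betaOneStar β j < y (k + j) at hj'
    have key : ∀ i ≤ j, s (k - 1 + i) ≤ qgOrbit β i := by
      intro i hi
      induction i with
      | zero => simpa using hs1 (k - 1)
      | succ i ih =>
        have h1 := h (k - 1 + i)
        have h2 : k - 1 + (i : ℤ) + 1 = k + i := by ring
        have h3 : k - 1 + ((i + 1 : ℕ) : ℤ) = k + i := by push_cast; ring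
        rw [h2, ← hj i (by omega), betaOneStar_eq hβ] at h1
        rw [h3, qgOrbit_succ, qgMap_eq hβ0 (qgOrbit_pos β i)]
        have := mul_le_mul_of_nonneg_left (ih (by omega)) hβ0.le
        linarith
    have h1 := h (k - 1 + j)
    have h2 : k - 1 + (j : ℤ) + 1 = k + j := by ring
    rw [h2] at h1
    have h3 := mul_le_mul_of_nonneg_left (key j le_rfl) hβ0.le
    have h4 := hs (k + j)
    rw [betaOneStar_eq hβ] at hj'
    have := (le_qgDigit_iff hβ0 (qgOrbit_pos β j) (y (k + j))).2 (by linarith)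
    omega

/-- The run remembers a number `m` such that the last `m` letters read are the first `m` letters of
`d*_β(1)`. The condition on the tail that starts at `j - m` bounds the next letter: equality
lengthens the match, a smaller letter resets it. -/
theorem exists_run_eq_qgOrbit (hβ : 1 < β) {f : ℕ → ℕ}
    (hf : ∀ n, toLex (fun i => f (n + i)) ≤ toLex (betaOneStar β)) (j : ℕ) :
    ∃ m ≤ j, runFrom β 1 f j = qgOrbit β m ∧ (∀ i < m, f (j - m + i) = betaOneStar β i) := by
  have hβ0 : 0 < β := by linarith
  induction j with
  | zero => exact ⟨0, le_rfl, rfl, by simp⟩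
  | succ j ih =>
    obtain ⟨m, hm, hrun, hdig⟩ := ih
    have h0 := qgOrbit_pos β m
    have hle : f j ≤ betaOneStar β m := by
      by_contra hlt
      refine absurd (hf (j - m)) (not_le.2 ⟨m, fun i hi => (hdig i hi).symm, ?_⟩)
      change betaOneStar β m < f (j - m + m)
      rw [Nat.sub_add_cancel hm]
      omega
    rw [betaOneStar_eq hβ] at hle
    rcases hle.lt_or_eq with h | h
    · exact ⟨0, by omega, by rw [runFrom, hrun, stateStep_of_lt hβ0 h0 h]; rfl, by simp⟩
    · refine ⟨m + 1, by omega, by rw [runFrom, hrun, h, stateStep_qgDigit hβ0 h0, qgOrbit_succ],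
        fun i hi => ?_⟩
      rw [Nat.add_sub_add_right]
      rcases Nat.lt_succ_iff_lt_or_eq.1 hi with hi | rfl
      · exact hdig i hi
      · rw [Nat.sub_add_cancel hm, h, betaOneStar_eq hβ]

theorem run_pos_of_mem_twoSidedShift (hβ : 1 < β) {y : ℤ → ℕ} (hy : y ∈ twoSidedShift β) (k : ℤ)
    (j : ℕ) : 0 < β * runFrom β 1 (fun n => y (k + n)) j - y (k + j) := by
  have hβ0 : 0 < β := by linarith
  have hf : ∀ n : ℕ, toLex (fun i : ℕ => (fun n : ℕ => y (k + n)) (n + i)) ≤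
      toLex (betaOneStar β) := by
    intro n
    have := hy.2 (k + n)
    simpa [add_assoc] using this
  obtain ⟨m, hm, hrun, hdig⟩ := exists_run_eq_qgOrbit hβ (f := fun n : ℕ => y (k + n)) hf j
  rw [hrun, ← le_qgDigit_iff hβ0 (qgOrbit_pos β m)]
  by_contra hlt
  refine absurd (hf (j - m)) (not_le.2 ⟨m, fun i hi => (hdig i hi).symm, ?_⟩)
  rw [not_le, ← betaOneStar_eq hβ] at hlt
  change betaOneStar β m < y (k + (j - m + m : ℕ))
  rwa [Nat.sub_add_cancel hm]

/-- A one-sided sequence that can be read from `1`, extended by zeros. -/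
def zeroExtend (f : ℕ → ℕ) (i : ℤ) : ℕ := if 0 ≤ i then f i.toNat else 0

theorem zeroExtend_mem (hβ : 1 < β) {f : ℕ → ℕ} (hf : ∀ j, 0 < β * runFrom β 1 f j - f j) :
    zeroExtend f ∈ twoSidedShift β := by
  have hβ0 : 0 < β := by linarith
  have hrun := fun n => runFrom_mem_range hβ0 (one_mem_range β) n fun j _ => hf j
  -- The state stays `1` before position `0`; the shift by one reflects that `y (k + 1)` is read
  -- from `s k`.
  refine mem_twoSidedShift_of_run hβ (s := fun k => runFrom β 1 f (k + 1).toNat)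
    (fun k => pos_of_mem_range (hrun _)) (fun k => le_one_of_mem_range (hrun _)) fun k => ?_
  by_cases hk : 0 ≤ k + 1
  · obtain ⟨n, hn⟩ := Int.eq_ofNat_of_zero_le hk
    have h1 : (k + 1 + 1).toNat = n + 1 := by omega
    have h2 : (k + 1).toNat = n := by omega
    simp only [zeroExtend, if_pos hk, h1, h2]
    exact stateStep_le _ _ _
  · have h1 : (k + 1 + 1).toNat = 0 := by omega
    have h2 : (k + 1).toNat = 0 := by omega
    simp only [zeroExtend, if_neg hk, h1, h2, runFrom]
    norm_num; exact hβ.le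

theorem run_getD_pos (hβ : 1 < β) {l : List ℕ} (hl : Adm β 1 l) (j : ℕ) :
    0 < β * runFrom β 1 (fun n => l.getD n 0) j - l.getD j 0 := by
  have hβ0 : 0 < β := by linarith
  rw [← map_range_getD l, adm_range_iff] at hl
  induction j using Nat.strong_induction_on with
  | _ j ih =>
    by_cases hj : j < l.length
    · exact hl j hj
    · rw [List.getD_eq_default _ _ (by omega)]
      have := pos_of_mem_range (runFrom_mem_range hβ0 (one_mem_range β) j ih)
      have := mul_pos hβ0 this
      simpa

/-- The language of the beta-shift is the set of words that can be read from `1`. -/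
theorem mem_factors_iff (hβ : 1 < β) (l : List ℕ) : l ∈ factors β ↔ Adm β 1 l := by
  constructor
  · rintro ⟨y, hy, k, hl⟩
    rw [hl, adm_range_iff]
    exact fun j _ => run_pos_of_mem_twoSidedShift hβ hy k j
  · intro hl
    refine ⟨_, zeroExtend_mem hβ (run_getD_pos hβ hl), 0, ?_⟩
    conv_lhs => rw [← map_range_getD l]
    refine List.map_congr_left fun n _ => ?_
    simp [zeroExtend]

/-! ### States of the minimal automaton as real numbers -/

theorem adm_qgDigit (hβ : 0 < β) {v : ℝ} (hv : 0 < v) (n : ℕ) :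
    runFrom β v (fun i => qgDigit β ((qgMap β)^[i] v)) n = (qgMap β)^[n] v ∧
      0 < β * (qgMap β)^[n] v - qgDigit β ((qgMap β)^[n] v) := by
  have hpos : ∀ i, 0 < (qgMap β)^[i] v := by
    intro i
    cases i with
    | zero => simpa
    | succ i => rw [Function.iterate_succ_apply']; exact qgMap_pos _ _
  refine ⟨?_, (le_qgDigit_iff hβ (hpos n) _).1 le_rfl⟩
  induction n with
  | zero => rfl
  | succ n ih => rw [runFrom, ih, stateStep_qgDigit hβ (hpos n), Function.iterate_succ_apply']

/-- Read the quasi-greedy expansion of `v` from both points. The deficit of `u` is at least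
multiplied by `β` at each step, until the run from `u` would become negative. -/
theorem not_lt_of_adm (hβ : 1 < β) {u v : ℝ} (hv : 0 < v)
    (h : ∀ l, Adm β v l → Adm β u l) : ¬ u < v := by
  intro huv
  have hβ0 : 0 < β := by linarith
  set f := fun i => qgDigit β ((qgMap β)^[i] v) with hf
  have hv' := adm_qgDigit hβ0 hv
  have hu : ∀ j, 0 < β * runFrom β u f j - f j := fun j =>
    (adm_range_iff u f (j + 1)).1 (h _ ((adm_range_iff v f (j + 1)).2 fun i _ => by
      rw [(hv' i).1]; exact (hv' i).2)) j (by omega)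
  have key : ∀ j, runFrom β u f j ≤ runFrom β v f j - β ^ j * (v - u) := by
    intro j
    induction j with
    | zero => simp [runFrom]
    | succ j ih =>
      have h1 := stateStep_le β (runFrom β u f j) (f j)
      have h2 := hv' j
      have h3 := (hv' (j + 1)).1
      have h5 : 0 < (qgMap β)^[j] v := by
        cases j with
        | zero => simpa
        | succ i => rw [Function.iterate_succ_apply']; exact qgMap_pos _ _
      rw [Function.iterate_succ_apply', qgMap_eq hβ0 h5] at h3
      rw [h3]
      rw [h2.1] at ih
      have h4 := mul_le_mul_of_nonneg_left ih hβ0.le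
      change stateStep β (runFrom β u f j) (f j) ≤ _
      change stateStep β (runFrom β u f j) (f j) ≤ β * runFrom β u f j - qgDigit β _ at h1
      rw [pow_succ']
      nlinarith
  have hd : 0 < v - u := by linarith
  obtain ⟨j, hj⟩ := pow_unbounded_of_one_lt (v - u)⁻¹ hβ
  rw [inv_lt_iff_one_lt_mul₀ hd] at hj
  have h1 := key (j + 1)
  have h2 : 0 < runFrom β u f (j + 1) := stateStep_pos_iff.2 (hu j)
  have h3 : runFrom β v f (j + 1) ≤ 1 := stateStep_le_one _ _ _
  rw [pow_succ'] at h1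
  nlinarith

theorem leftQuotient_factors (hβ : 1 < β) {w : List ℕ} (hw : Adm β 1 w) (l : List ℕ) :
    l ∈ (factors β).leftQuotient w ↔ Adm β (w.foldl (stateStep β) 1) l := by
  rw [Language.mem_leftQuotient, mem_factors_iff hβ, adm_append]
  exact and_iff_right hw

theorem exists_mem_of_language_ne_zero {α : Type*} {L : Language α} (h : L ≠ 0) : ∃ l, l ∈ L := by
  by_contra! hL
  exact h (Language.ext fun l => iff_of_false (hL l) (Language.notMem_zero l))

/-- The real number that represents a state of the minimal automaton. -/
def State.val (q : State β) : ℝ := q.1.2.choose.foldl (stateStep β) 1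

theorem State.adm_choose (hβ : 1 < β) (q : State β) : Adm β 1 q.1.2.choose := by
  obtain ⟨l, hl⟩ := exists_mem_of_language_ne_zero q.2
  have h : (factors β).leftQuotient q.1.2.choose = q.1 := q.1.2.choose_spec
  rw [← h, Language.mem_leftQuotient, mem_factors_iff hβ, adm_append] at hl
  exact hl.1

theorem State.mem_iff (hβ : 1 < β) (q : State β) (l : List ℕ) :
    l ∈ (q.1 : Language ℕ) ↔ Adm β q.val l := by
  rw [State.val, ← leftQuotient_factors hβ (q.adm_choose hβ), q.1.2.choose_spec]

theorem State.val_mem (hβ : 1 < β) (q : State β) : q.val ∈ Set.range (qgOrbit β) :=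
  foldl_mem_range (by linarith) (one_mem_range β) (q.adm_choose hβ)

theorem State.val_pos (hβ : 1 < β) (q : State β) : 0 < q.val := pos_of_mem_range (q.val_mem hβ)

theorem State.val_le_one (hβ : 1 < β) (q : State β) : q.val ≤ 1 :=
  le_one_of_mem_range (q.val_mem hβ)

/-- Follower languages determine the real number. In particular the value of a state does not depend
on the word chosen in `State.val`. -/
theorem eq_of_adm_iff (hβ : 1 < β) {u v : ℝ} (hu : 0 < u) (hv : 0 < v)
    (h : ∀ l, Adm β u l ↔ Adm β v l) : u = v :=
  le_antisymm (not_lt.1 (not_lt_of_adm hβ hu fun l => (h l).1))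
    (not_lt.1 (not_lt_of_adm hβ hv fun l => (h l).2))

theorem State.val_injective (hβ : 1 < β) : Function.Injective (State.val (β := β)) := by
  intro p q h
  refine Subtype.ext (Subtype.ext (Language.ext fun l => ?_))
  rw [p.mem_iff hβ, q.mem_iff hβ, h]

theorem State.exists_val_eq (hβ : 1 < β) {u : ℝ} (hu : u ∈ Set.range (qgOrbit β)) :
    ∃ q : State β, q.val = u := by
  have hβ0 : 0 < β := by linarith
  obtain ⟨k, rfl⟩ := hu
  have h := adm_qgDigit hβ0 one_pos
  set f := fun i => qgDigit β ((qgMap β)^[i] 1)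
  have hw : Adm β 1 ((List.range k).map f) := (adm_range_iff 1 f k).2 fun j _ => by
    rw [(h j).1]; exact (h j).2
  have hfold : ((List.range k).map f).foldl (stateStep β) 1 = qgOrbit β k := by
    rw [foldl_range, (h k).1]; rfl
  have hmem := leftQuotient_factors hβ hw
  rw [hfold] at hmem
  let q : State β := ⟨⟨_, (List.range k).map f, rfl⟩, fun h0 => by
    have h1 := (hmem []).2 trivial
    rw [show (factors β).leftQuotient ((List.range k).map f) = 0 from h0] at h1
    exact Language.notMem_zero _ h1⟩
  refine ⟨q, eq_of_adm_iff hβ (q.val_pos hβ) (qgOrbit_pos β k) fun l => ?_⟩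
  rw [← q.mem_iff hβ]
  exact hmem l

/-- The states of the minimal automaton correspond to the points of the quasi-greedy orbit. -/
def stateEquiv (hβ : 1 < β) : State β ≃ Set.range (qgOrbit β) :=
  Equiv.ofBijective (fun q => ⟨q.val, q.val_mem hβ⟩)
    ⟨fun _ _ h => State.val_injective hβ (congrArg Subtype.val h),
      fun u => (State.exists_val_eq hβ u.2).imp fun _ h => Subtype.ext h⟩

theorem mem_edge_target_iff (p : State β) (a : ℕ) (l : List ℕ) :
    l ∈ ((factors β).toDFA.step p.1 a : Language ℕ) ↔ a :: l ∈ (p.1 : Language ℕ) := by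
  rw [Language.step_toDFA]; exact Iff.rfl

/-- The language of the target is the quotient by `a` of the language of `p`. It is non-empty
exactly when `a` is readable, so excluding the dead state amounts to positivity. -/
theorem edge_iff (hβ : 1 < β) (p : State β) (a : ℕ) (q : State β) :
    Edge β p a q ↔ 0 < β * p.val - a ∧ q.val = stateStep β p.val a := by
  constructor
  · intro h
    have hq : ∀ l, l ∈ (q.1 : Language ℕ) ↔ Adm β p.val (a :: l) := fun l => by
      rw [← p.mem_iff hβ, ← mem_edge_target_iff, show _ = _ from h]
    obtain ⟨l, hl⟩ := exists_mem_of_language_ne_zero q.2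
    have hpos := ((hq l).1 hl).1
    refine ⟨hpos, eq_of_adm_iff hβ (q.val_pos hβ) (stateStep_pos_iff.2 hpos) fun l => ?_⟩
    rw [← q.mem_iff hβ, hq]
    exact and_iff_right hpos
  · rintro ⟨hpos, hval⟩
    refine Subtype.ext (Language.ext fun l => ?_)
    rw [mem_edge_target_iff, p.mem_iff hβ, q.mem_iff hβ, hval]
    exact and_iff_right hpos

theorem exists_edge (hβ : 1 < β) {p : State β} {a : ℕ} (h : 0 < β * p.val - a) :
    ∃ q, Edge β p a q := by
  obtain ⟨q, hq⟩ := State.exists_val_eq hβ (stateStep_mem_range (by linarith) (p.val_mem hβ) h)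
  exact ⟨q, (edge_iff hβ p a q).2 ⟨h, hq⟩⟩

theorem Edge.unique {p : State β} {a : ℕ} {q q' : State β} (h : Edge β p a q)
    (h' : Edge β p a q') : q = q' := Subtype.ext (h.symm.trans h')

theorem Edge.le_floor (hβ : 1 < β) {p : State β} {a : ℕ} {q : State β} (h : Edge β p a q) :
    a ≤ ⌊β⌋₊ := by
  have h1 := ((edge_iff hβ p a q).1 h).1
  have := mul_le_mul_of_nonneg_left (p.val_le_one hβ) (by linarith : 0 ≤ β)
  exact Nat.le_floor (by linarith)

instance finite_arrow [Fact (IsPisot β)] [Finite (State β)] : Finite (Arrow β) := by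
  have hβ : 1 < β := (Fact.out : IsPisot β).one_lt
  refine Finite.of_injective
    (fun e : Arrow β => (e.1.1, (⟨e.1.2.1, Nat.lt_succ_of_le (e.2.le_floor hβ)⟩ :
      Fin (⌊β⌋₊ + 1)), e.1.2.2)) fun e e' h => Subtype.ext ?_
  simp only [Prod.mk.injEq, Fin.mk.injEq] at h
  exact Prod.ext h.1 (Prod.ext h.2.1 h.2.2)

end

section

variable (β : ℝ)

/-! ### The Archimedean places of `ℚ(β)` -/

/-- The embedding of `ℚ(β)` into `ℂ` by the inclusion into `ℝ`. -/
def stdEmbedding : QBeta β →+* ℂ := (algebraMap ℝ ℂ).comp (algebraMap (QBeta β) ℝ)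

/-- The place of `ℚ(β)` given by the inclusion into `ℝ`. -/
def stdPlace : InfinitePlace (QBeta β) := InfinitePlace.mk (stdEmbedding β)

theorem stdPlace_apply (x : QBeta β) : stdPlace β x = |(x : ℝ)| := by
  rw [stdPlace, InfinitePlace.apply, stdEmbedding, RingHom.comp_apply, ← Real.norm_eq_abs]
  exact Complex.norm_real _

theorem isReal_stdPlace : (stdPlace β).IsReal :=
  ⟨stdEmbedding β, by ext x; exact Complex.conj_ofReal _, rfl⟩

theorem coe_gen : ((gen β : QBeta β) : ℝ) = β := IntermediateField.AdjoinSimple.coe_gen ℚ β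

variable [hβ : Fact (IsPisot β)]

theorem one_lt_beta : 1 < β := hβ.out.one_lt

theorem beta_pos : 0 < β := one_pos.trans (one_lt_beta β)

theorem gen_ne_zero : gen β ≠ 0 := fun h => by
  have h1 := coe_gen β
  rw [h] at h1
  have := beta_pos β
  simp at h1
  linarith

theorem isIntegral_gen : IsIntegral ℤ (gen β) := by
  refine (isIntegral_algebraMap_iff (algebraMap (QBeta β) ℝ).injective).1 ?_
  exact (coe_gen β).symm ▸ hβ.out.isIntegral

/-- The element `β` of the ring of integers of `ℚ(β)`. -/
def genInt : 𝓞 (QBeta β) := ⟨gen β, isIntegral_gen β⟩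

theorem coe_genInt : (genInt β : QBeta β) = gen β := rfl

theorem genInt_ne_zero : genInt β ≠ 0 := fun h => gen_ne_zero β (congrArg Subtype.val h)

variable {β}

/-- An embedding of `ℚ(β)` is determined by the image of `β`, so any non-standard one sends `β` to a
conjugate other than `β` itself. -/
theorem norm_embedding_gen_lt_one {φ : QBeta β →+* ℂ} (h : φ ≠ stdEmbedding β) :
    ‖φ (gen β)‖ < 1 := by
  refine hβ.out.norm_conjugate_lt _ ?_ fun he => h ?_
  · have h1 : Polynomial.aeval (gen β) (minpoly ℚ β) = 0 := by
      rw [← IntermediateField.minpoly_gen ℚ β]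
      exact minpoly.aeval ℚ _
    have h2 := Polynomial.aeval_algHom_apply φ.toRatAlgHom (gen β) (minpoly ℚ β)
    rw [h1, map_zero] at h2
    exact h2
  · have h1 : φ.toRatAlgHom = (stdEmbedding β).toRatAlgHom := by
      refine IntermediateField.algHom_ext_of_eq_adjoin (S := ℚ⟮β⟯) _ rfl ?_
      intro x hx
      obtain rfl : β = x := (Set.mem_singleton_iff.1 hx).symm
      change φ (gen β) = stdEmbedding β (gen β)
      rw [he, stdEmbedding, RingHom.comp_apply]
      exact congrArg _ (coe_gen β).symm
    exact RingHom.ext fun x => DFunLike.congr_fun h1 x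

theorem place_gen_lt_one {w : InfinitePlace (QBeta β)} (h : w ≠ stdPlace β) : w (gen β) < 1 := by
  rw [← InfinitePlace.norm_embedding_eq]
  refine norm_embedding_gen_lt_one fun he => h ?_
  rw [← w.mk_embedding, he]; rfl

theorem ne_stdPlace (v : ArchPlace β) : v.1 ≠ stdPlace β := by
  intro h
  have h1 := v.2
  rw [h, stdPlace_apply, coe_gen, abs_of_pos (beta_pos β)] at h1
  exact lt_asymm h1 (one_lt_beta β)

open Classical in
-- The norm is the product over all Archimedean places. The standard one contributes `β`, and the
-- Pisot property puts all the others into `ArchPlace β`.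
theorem prod_archPlace [Fintype (ArchPlace β)] :
    β * ∏ v : ArchPlace β, v.1 (gen β) ^ v.1.mult = |Algebra.norm ℚ (gen β)| := by
  rw [← InfinitePlace.prod_eq_abs_norm, ← Finset.mul_prod_erase _ _ (Finset.mem_univ (stdPlace β)),
    stdPlace_apply, coe_gen, abs_of_pos (beta_pos β), (isReal_stdPlace β).mult_eq_one, pow_one]
  congr 1
  refine Finset.prod_nbij (fun v => v.1) (fun v _ => ?_) Subtype.val_injective.injOn
    (fun w hw => ?_) fun _ _ => rfl
  · simpa using ne_stdPlace v
  · exact ⟨⟨w, place_gen_lt_one (by simpa using hw)⟩, by simp, rfl⟩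

/-! ### Finiteness of the quasi-greedy orbit. -/

variable (β) in
/-- The quasi-greedy orbit of `1` as a sequence in `ℚ(β)`. -/
def qgOrbitQ : ℕ → QBeta β
  | 0 => 1
  | k + 1 => gen β * qgOrbitQ k - (qgDigit β (qgOrbit β k) : QBeta β)

theorem coe_qgOrbitQ (k : ℕ) : (qgOrbitQ β k : ℝ) = qgOrbit β k := by
  induction k with
  | zero => simp [qgOrbitQ]
  | succ k ih =>
    rw [qgOrbit_succ, qgMap_eq (beta_pos β) (qgOrbit_pos β k), qgOrbitQ, ← ih]
    push_cast
    rw [coe_gen]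

theorem isIntegral_qgOrbitQ (k : ℕ) : IsIntegral ℤ (qgOrbitQ β k) := by
  induction k with
  | zero => exact isIntegral_one
  | succ k ih =>
    refine ((isIntegral_gen β).mul ih).sub ?_
    exact_mod_cast isIntegral_algebraMap (R := ℤ) (A := QBeta β) (x := (qgDigit β (qgOrbit β k) : ℤ))

theorem qgDigit_le (k : ℕ) : (qgDigit β (qgOrbit β k) : ℝ) ≤ β := by
  have h1 := (le_qgDigit_iff (beta_pos β) (qgOrbit_pos β k) _).1 le_rfl
  have h2 := mul_le_mul_of_nonneg_left (qgOrbit_le_one β k) (beta_pos β).le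
  linarith

/-- At the standard embedding the orbit stays in `(0, 1]`; at any other one the recursion contracts
by `‖φ β‖ < 1` and adds a digit of size at most `β`. Algebraic integers bounded at all embeddings
are finite in number. -/
theorem exists_norm_qgOrbitQ_le (φ : QBeta β →+* ℂ) : ∃ B : ℝ, 0 ≤ B ∧ ∀ k,
    ‖φ (qgOrbitQ β k)‖ ≤ B := by
  have hb := beta_pos β
  by_cases h : φ = stdEmbedding β
  · refine ⟨1, zero_le_one, fun k => ?_⟩
    rw [h, stdEmbedding, RingHom.comp_apply]
    change ‖((qgOrbitQ β k : ℝ) : ℂ)‖ ≤ 1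
    rw [coe_qgOrbitQ, Complex.norm_real, Real.norm_of_nonneg (qgOrbit_pos β k).le]
    exact qgOrbit_le_one β k
  · set r := ‖φ (gen β)‖
    have hr : r < 1 := norm_embedding_gen_lt_one h
    have hr0 : 0 ≤ r := norm_nonneg _
    -- This bound `B` satisfies `r * B + β ≤ B` and is at least the initial value `1`.
    refine ⟨1 + β / (1 - r), by have := div_nonneg hb.le (sub_pos.2 hr).le; linarith, fun k => ?_⟩
    induction k with
    | zero =>
      rw [qgOrbitQ, map_one, norm_one]
      have := div_nonneg hb.le (sub_pos.2 hr).le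
      linarith
    | succ k ih =>
      rw [qgOrbitQ, map_sub, map_mul, map_natCast]
      have h1 : ‖(qgDigit β (qgOrbit β k) : ℂ)‖ ≤ β := by
        rw [Complex.norm_natCast]; exact qgDigit_le k
      have h2 := norm_sub_le (φ (gen β) * φ (qgOrbitQ β k)) (qgDigit β (qgOrbit β k) : ℂ)
      rw [norm_mul] at h2
      have h3 := mul_le_mul_of_nonneg_left ih hr0
      have h4 : r * (1 + β / (1 - r)) + β = r + β / (1 - r) := by
        have : 1 - r ≠ 0 := (sub_pos.2 hr).ne'
        field_simp; ring
      linarith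

/-- The quasi-greedy orbit of `1` is finite for a Pisot number. -/
theorem finite_range_qgOrbit : (Set.range (qgOrbit β)).Finite := by
  choose B hB0 hB using exists_norm_qgOrbitQ_le (β := β)
  refine ((Embeddings.finite_of_norm_le (QBeta β) ℂ (∑ φ, B φ)).image
    (fun x : QBeta β => (x : ℝ))).subset ?_
  rintro _ ⟨k, rfl⟩
  refine ⟨qgOrbitQ β k, ⟨isIntegral_qgOrbitQ k, fun φ => (hB φ k).trans ?_⟩, coe_qgOrbitQ k⟩
  exact Finset.single_le_sum (fun φ _ => hB0 φ) (Finset.mem_univ φ)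

instance finite_state : Finite (State β) :=
  have : Finite (Set.range (qgOrbit β)) := finite_range_qgOrbit
  Finite.of_equiv _ (stateEquiv (one_lt_beta β)).symm

theorem card_state : Nat.card (State β) = numPieces β := by
  rw [Nat.card_congr (stateEquiv (one_lt_beta β)),
    card_range_qgOrbit (one_lt_beta β) finite_range_qgOrbit]

end

section

variable {β : ℝ}

/-- The states `q` form a path with label `w` in the automaton with reversed arrows. -/
def IsBackwardPath (w : ℕ → ℕ) (q : ℕ → State β) : Prop := ∀ k, Edge β (q (k + 1)) (w k) (q k)

theorem isBackwardPath_past {y : ℤ → ℕ} {q : ℤ → State β}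
    (h : ∀ k, Edge β (q k) (y (k + 1)) (q (k + 1))) :
    IsBackwardPath (past y) fun n => q (-n) := by
  intro n
  have h1 := h (-(n + 1 : ℕ))
  have h2 : -((n + 1 : ℕ) : ℤ) + 1 = -n := by omega
  rwa [h2] at h1

variable [hβ : Fact (IsPisot β)]

/-! ### Coordinates of the representation space -/

theorem norm_canonicalEmbedding_fst (x : QBeta β) (v : ArchPlace β) :
    ‖(canonicalEmbedding β x).1 v‖ = v.1 x := InfinitePlace.Completion.norm_coe _ _

theorem norm_canonicalEmbedding_snd_lt_one (v : PrimePlace β) :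
    ‖(canonicalEmbedding β (gen β)).2 v‖ < 1 := by
  change ‖algebraMap (QBeta β) (v.1.adicCompletion (QBeta β)) (gen β)‖ < 1
  rw [FinitePlace.norm_def]
  have hv : Valued.v (algebraMap (QBeta β) (v.1.adicCompletion (QBeta β)) (gen β)) < 1 :=
    (HeightOneSpectrum.valuedAdicCompletion_eq_valuation' v.1 (gen β)).trans_lt v.2
  exact_mod_cast (WithZeroMulInt.toNNReal_lt_one_iff
    (HeightOneSpectrum.one_lt_absNorm_nnreal v.1)).2 hv

theorem norm_canonicalEmbedding_fst_lt_one (v : ArchPlace β) :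
    ‖(canonicalEmbedding β (gen β)).1 v‖ < 1 := (norm_canonicalEmbedding_fst _ v).trans_lt v.2

theorem canonicalEmbedding_fst_ne_zero {x : QBeta β} (hx : x ≠ 0) (v : ArchPlace β) :
    (canonicalEmbedding β x).1 v ≠ 0 :=
  fun h => hx ((algebraMap (QBeta β) v.1.Completion).injective (h.trans (map_zero _).symm))

theorem canonicalEmbedding_snd_ne_zero {x : QBeta β} (hx : x ≠ 0) (v : PrimePlace β) :
    (canonicalEmbedding β x).2 v ≠ 0 :=
  fun h => hx ((algebraMap (QBeta β) (v.1.adicCompletion (QBeta β))).injective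
    (h.trans (map_zero _).symm))

theorem isAffineContraction_affineMap (a : ℕ) : IsAffineContraction β (affineMap β a) :=
  ⟨canonicalEmbedding β (gen β), canonicalEmbedding β a,
    fun v => ⟨norm_pos_iff.2 (canonicalEmbedding_fst_ne_zero (gen_ne_zero β) v),
      norm_canonicalEmbedding_fst_lt_one v⟩,
    fun v => ⟨norm_pos_iff.2 (canonicalEmbedding_snd_ne_zero (gen_ne_zero β) v),
      norm_canonicalEmbedding_snd_lt_one v⟩, fun _ => rfl⟩

/-! ### The series of the representation map -/

theorem norm_natCast_mul_pow_le {F : Type*} [NormedField F] {n M : ℕ} (h : n ≤ M) (x : F)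
    (i : ℕ) : ‖(n : F) * x ^ i‖ ≤ M * ‖x‖ ^ i := by
  rw [norm_mul, norm_pow]
  refine mul_le_mul_of_nonneg_right ((Nat.norm_cast_le _).trans ?_) (by positivity)
  simpa using h

theorem summable_natCast_mul_pow {F : Type*} [NormedField F] [CompleteSpace F] {w : ℕ → ℕ} {M : ℕ}
    (hw : ∀ i, w i ≤ M) {x : F} (hx : ‖x‖ < 1) : Summable fun i => (w i : F) * x ^ i :=
  Summable.of_norm_bounded ((summable_geometric_of_lt_one (norm_nonneg _) hx).mul_left (M : ℝ))
    fun i => norm_natCast_mul_pow_le (hw i) x i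

theorem hasSum_rep {w : ℕ → ℕ} {M : ℕ} (hw : ∀ i, w i ≤ M) :
    HasSum (fun i => canonicalEmbedding β (w i : QBeta β) * canonicalEmbedding β (gen β) ^ i)
      ((fun v => ∑' i, (w i : v.1.Completion) * (canonicalEmbedding β (gen β)).1 v ^ i,
        fun v => ∑' i, (w i : v.1.adicCompletion (QBeta β)) *
          (canonicalEmbedding β (gen β)).2 v ^ i) : RepSpace β) := by
  refine HasSum.prodMk (Pi.hasSum.2 fun v => ?_) (Pi.hasSum.2 fun v => ?_)
  · have := (summable_natCast_mul_pow hw (norm_canonicalEmbedding_fst_lt_one v)).hasSum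
    refine this.congr_fun fun i => ?_
    change algebraMap (QBeta β) v.1.Completion (w i) * _ = _
    rw [map_natCast]; rfl
  · have := (summable_natCast_mul_pow hw (norm_canonicalEmbedding_snd_lt_one v)).hasSum
    refine this.congr_fun fun i => ?_
    change algebraMap (QBeta β) (v.1.adicCompletion (QBeta β)) (w i) * _ = _
    rw [map_natCast]; rfl

theorem rep_cons {w : ℕ → ℕ} {M : ℕ} (hw : ∀ i, w i ≤ M) :
    rep β w = affineMap β (w 0) (rep β (shiftSeq w)) := by
  rw [rep, (hasSum_rep hw).summable.tsum_eq_zero_add, affineMap, add_comm, pow_zero, mul_one, rep,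
    ← (hasSum_rep (w := shiftSeq w) fun i => hw (i + 1)).summable.tsum_mul_left]
  congr 1
  refine tsum_congr fun i => ?_
  rw [pow_succ', shiftSeq]; ring

theorem continuous_rep {X : Type*} [TopologicalSpace X] {M : ℕ} (d : X → ℕ → ℕ)
    (hd : ∀ i, Continuous fun x => d x i) (hM : ∀ x i, d x i ≤ M) :
    Continuous fun x => rep β (d x) := by
  have h : (fun x => rep β (d x)) = fun x => ((fun v => ∑' i, (d x i : v.1.Completion) *
      (canonicalEmbedding β (gen β)).1 v ^ i, fun v => ∑' i,
        (d x i : v.1.adicCompletion (QBeta β)) * (canonicalEmbedding β (gen β)).2 v ^ i) :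
        RepSpace β) := funext fun x => (hasSum_rep (hM x)).tsum_eq
  rw [h]
  refine Continuous.prodMk (continuous_pi fun v => ?_) (continuous_pi fun v => ?_)
  · refine continuous_tsum (fun i => ?_) ((summable_geometric_of_lt_one (norm_nonneg _)
      (norm_canonicalEmbedding_fst_lt_one v)).mul_left (M : ℝ))
      fun i x => norm_natCast_mul_pow_le (hM x i) _ i
    exact (continuous_of_discreteTopology.comp (hd i)).mul continuous_const
  · refine continuous_tsum (fun i => ?_) ((summable_geometric_of_lt_one (norm_nonneg _)
      (norm_canonicalEmbedding_snd_lt_one v)).mul_left (M : ℝ))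
      fun i x => norm_natCast_mul_pow_le (hM x i) _ i
    exact (continuous_of_discreteTopology.comp (hd i)).mul continuous_const

/-! ### Paths of the automaton and the pieces -/

theorem IsBackwardPath.le_floor {w : ℕ → ℕ} {q : ℕ → State β} (h : IsBackwardPath w q) (i : ℕ) :
    w i ≤ ⌊β⌋₊ := (h i).le_floor (one_lt_beta β)

/-- Removing the first reversed arrow leaves a backward path from the origin of that arrow, and
splitting off the term `i = 0` of the series turns this into the affine map. -/
theorem rauzyPiece_eq (s : State β) :
    rauzyPiece β s = ⋃ e : {e : Arrow β // e.1.2.2 = s},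
      affineMap β e.1.1.2.1 '' rauzyPiece β e.1.1.1 := by
  ext x
  simp only [Set.mem_iUnion]
  constructor
  · rintro ⟨w, q, rfl, hq, rfl⟩
    exact ⟨⟨⟨(q 1, w 0, q 0), hq 0⟩, rfl⟩, rep β (shiftSeq w),
      ⟨shiftSeq w, fun k => q (k + 1), rfl, fun k => hq (k + 1), rfl⟩,
      (rep_cons (IsBackwardPath.le_floor hq)).symm⟩
  · rintro ⟨⟨⟨⟨p, a, t⟩, he⟩, rfl⟩, _, ⟨w, q, hq0, hq, rfl⟩, rfl⟩
    have hq' : IsBackwardPath (fun n => Nat.casesOn n a w) (fun n => Nat.casesOn n t q) := by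
      rintro (_ | k)
      · change Edge β (q 0) a t
        rw [hq0]; exact he
      · exact hq k
    exact ⟨_, _, rfl, hq', (rep_cons hq'.le_floor).symm⟩

/-- The labelled backward paths from `s` form a closed subset of a product of finite discrete
spaces, and the representation map is continuous there by uniform geometric bounds. -/
theorem isCompact_rauzyPiece (s : State β) : IsCompact (rauzyPiece β s) := by
  let _ : TopologicalSpace (State β) := ⊥
  have : DiscreteTopology (State β) := ⟨rfl⟩
  let C : Set (ℕ → Fin (⌊β⌋₊ + 1) × State β) :=
    {x | (x 0).2 = s ∧ ∀ k, Edge β (x (k + 1)).2 (x k).1 (x k).2}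
  have happ : ∀ k, Continuous fun x : ℕ → Fin (⌊β⌋₊ + 1) × State β => x k := continuous_apply
  have hC : IsClosed C := by
    refine IsClosed.inter ?_ ?_
    · exact (isClosed_discrete {z : Fin (⌊β⌋₊ + 1) × State β | z.2 = s}).preimage
        (happ 0)
    · change IsClosed {x : ℕ → Fin (⌊β⌋₊ + 1) × State β |
        ∀ k, Edge β (x (k + 1)).2 (x k).1 (x k).2}
      rw [Set.ofPred_forall]
      refine isClosed_iInter fun k => ?_
      exact (isClosed_discrete {z : (Fin (⌊β⌋₊ + 1) × State β) × (Fin (⌊β⌋₊ + 1) × State β) |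
        Edge β z.1.2 z.2.1 z.2.2}).preimage
        ((happ (k + 1)).prodMk (happ k))
  have hcont : Continuous fun x : ℕ → Fin (⌊β⌋₊ + 1) × State β =>
      rep β fun i => ((x i).1 : ℕ) :=
    continuous_rep (M := ⌊β⌋₊) _ (fun i => continuous_of_discreteTopology.comp
      (continuous_fst.comp (continuous_apply i))) fun x i => Nat.lt_succ_iff.1 (x i).1.2
  convert hC.isCompact.image hcont using 1
  ext x
  constructor
  · rintro ⟨w, q, hq0, hq, rfl⟩
    exact ⟨fun i => (⟨w i, Nat.lt_succ_of_le (IsBackwardPath.le_floor hq i)⟩, q i),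
      ⟨hq0, hq⟩, rfl⟩
  · rintro ⟨x, ⟨hx0, hx⟩, rfl⟩
    exact ⟨_, fun i => (x i).2, hx0, hx, rfl⟩

/-- The two-sided sequence with past `w` and future `u`. -/
def glue (w u : ℕ → ℕ) (i : ℤ) : ℕ := if i ≤ 0 then w (-i).toNat else u (i - 1).toNat

theorem past_glue (w u : ℕ → ℕ) : past (glue w u) = w := by
  ext i
  simp [past, glue]

theorem glue_add_one (w u : ℕ → ℕ) (i : ℕ) : glue w u (i + 1) = u i := by
  have : ¬ ((i : ℤ) + 1 ≤ 0) := by omega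
  simp [glue, this]

theorem glue_mem {w u : ℕ → ℕ} {q : ℕ → State β} {r : ℕ → ℝ} (hq : IsBackwardPath w q)
    (hr0 : r 0 = (q 0).val) (hr : ∀ n, 0 < r n) (hr1 : ∀ n, r n ≤ 1)
    (h : ∀ n, r (n + 1) ≤ β * r n - u n) : glue w u ∈ twoSidedShift β := by
  have hb := one_lt_beta β
  refine mem_twoSidedShift_of_run hb
    (s := fun k => if k ≤ 0 then (q (-k).toNat).val else r k.toNat) (fun k => ?_) (fun k => ?_)
    fun k => ?_
  · split_ifs
    exacts [State.val_pos hb _, hr _]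
  · split_ifs
    exacts [State.val_le_one hb _, hr1 _]
  · rcases lt_trichotomy k 0 with hk | rfl | hk
    · have h1 : (-k).toNat = (-(k + 1)).toNat + 1 := by omega
      have h2 := ((edge_iff hb _ _ _).1 (hq (-(k + 1)).toNat)).2
      rw [if_pos (by omega), if_pos (by omega), glue, if_pos (by omega), h1, h2]
      exact stateStep_le _ _ _
    · simpa [glue, ← hr0] using h 0
    · obtain ⟨n, rfl⟩ := Int.eq_ofNat_of_zero_le hk.le
      have h1 : ((n : ℤ) + 1).toNat = n + 1 := by omega
      rw [if_neg (by omega), if_neg (by omega), glue_add_one, h1, Int.toNat_natCast]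
      exact h n

theorem IsBackwardPath.mem_leftShift {w : ℕ → ℕ} {q : ℕ → State β} (h : IsBackwardPath w q) :
    w ∈ leftShift β := by
  have hb := one_lt_beta β
  have h0 := (q 0).val_pos hb
  -- The future is all zeros; a constant run is allowed there, since multiplication by `β` only
  -- increases a positive value.
  refine ⟨_, glue_mem (u := fun _ => 0) (r := fun _ => (q 0).val) h rfl (fun _ => h0)
    (fun _ => (q 0).val_le_one hb) (fun _ => ?_), past_glue _ _⟩
  simp only [Nat.cast_zero, sub_zero]
  nlinarith

/-- Every element of the two-sided shift is the label of a two-sided path. -/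
theorem exists_path {y : ℤ → ℕ} (hy : y ∈ twoSidedShift β) :
    ∃ q : ℤ → State β, ∀ k, Edge β (q k) (y (k + 1)) (q (k + 1)) := by
  have hb := one_lt_beta β
  have hpos : ∀ (N n : ℕ), 0 < β * runFrom β 1 (fun n : ℕ => y (-N + 1 + n)) n - y (-N + 1 + n) :=
    fun N n => run_pos_of_mem_twoSidedShift hb hy _ n
  have hmem : ∀ (N n : ℕ), ∃ q : State β, q.val = runFrom β 1 (fun n : ℕ => y (-N + 1 + n)) n :=
    fun N n => State.exists_val_eq hb
      (runFrom_mem_range (beta_pos β) (one_mem_range β) n fun j _ => hpos N j)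
  choose st hst using hmem
  have hedge : ∀ (k : ℤ) (N : ℕ), -(N : ℤ) ≤ k →
      Edge β (st N (k + N).toNat) (y (k + 1)) (st N (k + 1 + N).toNat) := by
    intro k N hk
    obtain ⟨n, hn⟩ := Int.eq_ofNat_of_zero_le (by omega : 0 ≤ k + N)
    have h1 : (k + N).toNat = n := by omega
    have h2 : (k + 1 + N).toNat = n + 1 := by omega
    have h3 : k + 1 = -(N : ℤ) + 1 + n := by omega
    rw [h1, h2, h3, edge_iff hb, hst, hst]
    exact ⟨hpos N n, rfl⟩
  -- Compactness: `st N` is the run started in state `1` at position `-N`. There are finitely many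
  -- states, so along an ultrafilter the state at each position is eventually constant, and the
  -- limits are again joined by arrows.
  have hlim : ∀ k : ℤ, ∃ q : State β, ∀ᶠ N in (hyperfilter ℕ : Filter ℕ),
      st N (k + N).toNat = q := by
    intro k
    obtain ⟨q, hq⟩ := Ultrafilter.eq_pure_of_finite
      ((hyperfilter ℕ).map fun N => st N (k + N).toNat)
    refine ⟨q, ?_⟩
    have : {q} ∈ (hyperfilter ℕ).map fun N => st N (k + N).toNat := by
      rw [hq]; exact Ultrafilter.mem_pure.2 rfl
    exact Ultrafilter.mem_map.1 this
  choose q hq using hlim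
  refine ⟨q, fun k => ?_⟩
  have hlarge : ∀ᶠ N in (hyperfilter ℕ : Filter ℕ), (-k).toNat ≤ N :=
    Nat.hyperfilter_le_atTop (eventually_ge_atTop _)
  obtain ⟨N, h1, h2, h3⟩ := ((hq k).and ((hq (k + 1)).and hlarge)).exists
  rw [← h1, ← h2]
  exact hedge k N (by omega)

theorem rauzy_eq_iUnion : rauzy β = ⋃ s, rauzyPiece β s := by
  ext x
  simp only [Set.mem_iUnion]
  constructor
  · rintro ⟨_, ⟨y, hy, rfl⟩, rfl⟩
    obtain ⟨q, hq⟩ := exists_path hy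
    exact ⟨q 0, past y, fun n => q (-n), by simp, isBackwardPath_past hq, rfl⟩
  · rintro ⟨s, w, q, -, hq, rfl⟩
    exact ⟨w, IsBackwardPath.mem_leftShift hq, rfl⟩

theorem isCompact_rauzy : IsCompact (rauzy β) := by
  rw [rauzy_eq_iUnion]
  exact isCompact_iUnion fun s => isCompact_rauzyPiece s

/-! ### The two-sided fractal -/

/-- Take the smaller of `⌊βx⌋` and the quasi-greedy digit of `r`. In the first case below that digit
the new state is `1` and the new remainder is at most `1`; otherwise `x ≤ r` is just multiplied by
`β` and shifted. -/
theorem exists_digit {x r : ℝ} (hx : 0 ≤ x) (hxr : x ≤ r) (hr : 0 < r) :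
    ∃ a : ℕ, 0 < β * r - a ∧ 0 ≤ β * x - a ∧ β * x - a ≤ stateStep β r a := by
  have hb := beta_pos β
  have h0 : 0 ≤ β * x := mul_nonneg hb.le hx
  have hfl := Nat.floor_le h0
  rcases lt_or_ge ⌊β * x⌋₊ (qgDigit β r) with h | h
  · refine ⟨_, (le_qgDigit_iff hb hr _).1 h.le, by linarith, ?_⟩
    rw [stateStep_of_lt hb hr h]
    linarith [Nat.lt_floor_add_one (β * x)]
  · have h1 : (qgDigit β r : ℝ) ≤ ⌊β * x⌋₊ := by exact_mod_cast h
    refine ⟨_, (le_qgDigit_iff hb hr _).1 le_rfl, by linarith, ?_⟩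
    rw [stateStep_qgDigit hb hr, qgMap_eq hb hr]
    linarith [mul_le_mul_of_nonneg_left hxr hb.le]

theorem sum_digits_eq {u : ℕ → ℕ} {x : ℕ → ℝ} (hx : ∀ n, x (n + 1) = β * x n - u n) (n : ℕ) :
    ∑ i ∈ Finset.range n, (u i : ℝ) * β⁻¹ ^ (i + 1) = x 0 - β⁻¹ ^ n * x n := by
  have hb := (beta_pos β).ne'
  induction n with
  | zero => simp
  | succ n ih =>
    rw [Finset.sum_range_succ, ih, hx, pow_succ]
    field_simp
    ring

/-- The sum telescopes up to the remainder `β⁻¹ ^ n * r n`, which is positive. -/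
theorem sum_digits_le {u : ℕ → ℕ} {r : ℕ → ℝ} (hr : ∀ n, 0 < r n)
    (h : ∀ n, r (n + 1) ≤ β * r n - u n) (n : ℕ) :
    ∑ i ∈ Finset.range n, (u i : ℝ) * β⁻¹ ^ (i + 1) ≤ r 0 := by
  have hb := beta_pos β
  suffices hs : ∑ i ∈ Finset.range n, (u i : ℝ) * β⁻¹ ^ (i + 1) ≤ r 0 - β⁻¹ ^ n * r n by
    have : 0 < β⁻¹ ^ n * r n := mul_pos (by positivity) (hr n)
    linarith
  induction n with
  | zero => simp
  | succ n ih =>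
    rw [Finset.sum_range_succ]
    have h1 := mul_le_mul_of_nonneg_left (h n) (by positivity : 0 ≤ β⁻¹ ^ (n + 1))
    have h2 : β⁻¹ ^ (n + 1) * (β * r n - u n) = β⁻¹ ^ n * r n - u n * β⁻¹ ^ (n + 1) := by
      rw [pow_succ]; field_simp
    linarith

theorem exists_expansion {x₀ r₀ : ℝ} (hx : 0 ≤ x₀) (hxr : x₀ ≤ r₀) (hr : 0 < r₀) (hr1 : r₀ ≤ 1) :
    ∃ (u : ℕ → ℕ) (r : ℕ → ℝ), r 0 = r₀ ∧ (∀ n, 0 < r n) ∧ (∀ n, r n ≤ 1) ∧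
      (∀ n, r (n + 1) ≤ β * r n - u n) ∧ HasSum (fun i => (u i : ℝ) * β⁻¹ ^ (i + 1)) x₀ := by
  have hb := one_lt_beta β
  have hb0 := beta_pos β
  -- Pairs of a remainder still to be expanded and an automaton state bounding it; the invariant is
  -- what `exists_digit` preserves.
  let Z := {z : ℝ × ℝ // 0 ≤ z.1 ∧ z.1 ≤ z.2 ∧ 0 < z.2 ∧ z.2 ≤ 1}
  have hex : ∀ z : Z, ∃ a : ℕ, 0 < β * z.1.2 - a ∧ 0 ≤ β * z.1.1 - a ∧
    β * z.1.1 - a ≤ stateStep β z.1.2 a := fun z => exists_digit z.2.1 z.2.2.1 z.2.2.2.1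
  choose a ha1 ha2 ha3 using hex
  let z : ℕ → Z := fun n => Nat.rec ⟨(x₀, r₀), hx, hxr, hr, hr1⟩ (fun _ z =>
    ⟨(β * z.1.1 - a z, stateStep β z.1.2 (a z)), ha2 z, ha3 z, stateStep_pos_iff.2 (ha1 z),
      stateStep_le_one _ _ _⟩) n
  refine ⟨fun n => a (z n), fun n => (z n).1.2, rfl, fun n => (z n).2.2.2.1,
    fun n => (z n).2.2.2.2, fun n => stateStep_le _ _ _, ?_⟩
  rw [hasSum_iff_tendsto_nat_of_nonneg (fun i => by positivity)]
  have h1 := sum_digits_eq (β := β) (u := fun n => a (z n)) (x := fun n => (z n).1.1) fun n => rfl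
  have hpow := tendsto_pow_atTop_nhds_zero_of_lt_one (inv_nonneg.2 hb0.le) (inv_lt_one_of_one_lt₀ hb)
  have h2 : Tendsto (fun n => β⁻¹ ^ n * (z n).1.1) atTop (nhds 0) :=
    squeeze_zero (fun n => mul_nonneg (by positivity) (z n).2.1)
      (fun n => mul_le_of_le_one_right (by positivity) ((z n).2.2.1.trans (z n).2.2.2.2)) hpow
  simp only [h1]
  have h3 := h2.const_sub (z 0).1.1
  rwa [sub_zero] at h3

/-- For a past that ends in the state `s`, the futures readable from `s` have sums at most `s.val`
(`sum_digits_le`), and every number in `[0, s.val]` is attained (`exists_expansion`). -/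
theorem rauzy₂_eq_iUnion :
    rauzy₂ β = ⋃ s : State β, (-rauzyPiece β s) ×ˢ Set.Icc (0 : ℝ) s.val := by
  have hb := one_lt_beta β
  have hb0 := beta_pos β
  ext ⟨z, x⟩
  simp only [Set.mem_iUnion, Set.mem_prod, Set.mem_neg, Set.mem_Icc]
  constructor
  · rintro ⟨y, hy, hyz⟩
    obtain ⟨q, hq⟩ := exists_path hy
    obtain ⟨rfl, rfl⟩ := Prod.mk.inj hyz
    refine ⟨q 0, ⟨past y, fun n => q (-n), by simp, isBackwardPath_past hq, neg_neg _⟩,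
      tsum_nonneg fun i => by positivity, ?_⟩
    refine Real.tsum_le_of_sum_range_le (fun i => by positivity) fun n => ?_
    refine sum_digits_le (u := fun i : ℕ => y (i + 1)) (r := fun n : ℕ => (q n).val)
      (fun n => State.val_pos hb _) (fun n => ?_) n
    simp only [Nat.cast_add, Nat.cast_one, ((edge_iff hb _ _ _).1 (hq n)).2]
    exact stateStep_le _ _ _
  · rintro ⟨s, ⟨w, q, rfl, hq, hz⟩, hx0, hx⟩
    obtain ⟨u, r, hr0, hr, hr1, h, hsum⟩ :=
      exists_expansion (β := β) hx0 hx (State.val_pos hb _) (State.val_le_one hb _)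
    refine ⟨glue w u, glue_mem hq hr0 hr hr1 h, Prod.ext ?_ ?_⟩
    · change -rep β (past (glue w u)) = z
      rw [past_glue, ← hz, neg_neg]
    · change ∑' i : ℕ, (glue w u (i + 1) : ℝ) * β⁻¹ ^ (i + 1) = x
      simp only [glue_add_one]
      exact hsum.tsum_eq

end

section

/-! ### Haar measure on the Archimedean completions -/

section Archimedean

variable {K : Type*} [Field K] (v : InfinitePlace K)

theorem properSpace_of_isometryEquiv {E F : Type*} [PseudoMetricSpace E] [PseudoMetricSpace F]
    [ProperSpace E] (e : F ≃ᵢ E) : ProperSpace F := by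
  refine ⟨fun x r => ?_⟩
  rw [← e.symm_apply_apply x, ← e.preimage_closedBall]
  exact e.toHomeomorph.isCompact_preimage.2 (isCompact_closedBall _ _)

instance properSpace_completion : ProperSpace v.Completion := by
  rcases v.isReal_or_isComplex with hv | hv
  · exact properSpace_of_isometryEquiv (InfinitePlace.Completion.isometryEquivRealOfIsReal hv)
  · exact properSpace_of_isometryEquiv (InfinitePlace.Completion.isometryEquivComplexOfIsComplex hv)

/-- Pulls Haar measure back from `ℝ` or `ℂ`; the dimension becomes the multiplicity of the place,
the exponent that occurs in the norm formula. -/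
theorem exists_haar_of_isometry {E F : Type*} [NormedAddCommGroup E] [NormedSpace ℝ E]
    [FiniteDimensional ℝ E] [NormedAddCommGroup F] [MeasurableSpace F] [BorelSpace F]
    (e : F ≃+ E) (he : Isometry e) : ∃ μ : Measure F, μ.IsAddHaarMeasure ∧ ∀ r : ℝ, 0 ≤ r →
      μ (Metric.closedBall 0 r) =
        ENNReal.ofReal (r ^ Module.finrank ℝ E) * μ (Metric.closedBall 0 1) := by
  let _ : MeasurableSpace E := borel E
  have : BorelSpace E := ⟨rfl⟩
  let f : F ≃ᵢ E := ⟨e.toEquiv, he⟩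
  have hcont : Continuous e.symm := f.symm.continuous
  let μ : Measure E := Measure.addHaar
  have hball : ∀ r, (μ.map e.symm) (Metric.closedBall 0 r) = μ (Metric.closedBall 0 r) := by
    intro r
    have h1 : (e.symm : E → F) ⁻¹' Metric.closedBall 0 r = Metric.closedBall 0 r := by
      have := f.symm.preimage_closedBall 0 r
      rw [f.symm_symm] at this
      change (e.symm : E → F) ⁻¹' Metric.closedBall 0 r = Metric.closedBall (e 0) r at this
      rwa [map_zero] at this
    rw [Measure.map_apply hcont.measurable Metric.isClosed_closedBall.measurableSet, h1]
  refine ⟨μ.map e.symm, e.symm.isAddHaarMeasure_map μ hcont he.continuous,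
    fun r hr => ?_⟩
  rw [hball, hball, Measure.addHaar_closedBall' μ 0 hr]

theorem exists_haar_completion [MeasurableSpace v.Completion] [BorelSpace v.Completion] :
    ∃ μ : Measure v.Completion, μ.IsAddHaarMeasure ∧ ∀ r : ℝ, 0 ≤ r →
      μ (Metric.closedBall 0 r) = ENNReal.ofReal (r ^ v.mult) * μ (Metric.closedBall 0 1) := by
  rcases v.isReal_or_isComplex with hv | hv
  · have := exists_haar_of_isometry
      (InfinitePlace.Completion.ringEquivRealOfIsReal hv).toAddEquiv
      (InfinitePlace.Completion.isometry_extensionEmbeddingOfIsReal hv)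
    rwa [Module.finrank_self, ← hv.mult_eq_one] at this
  · have := exists_haar_of_isometry
      (InfinitePlace.Completion.ringEquivComplexOfIsComplex hv).toAddEquiv
      (InfinitePlace.Completion.isometry_extensionEmbedding v)
    rwa [Complex.finrank_real_complex, ← hv.mult_eq_two] at this

end Archimedean

theorem norm_sub_le_max' {F : Type*} [SeminormedAddGroup F] [IsUltrametricDist F] (x y : F) :
    ‖x - y‖ ≤ max ‖x‖ ‖y‖ := by
  rw [sub_eq_add_neg, ← norm_neg y]
  exact IsUltrametricDist.norm_add_le_max x (-y)

variable {β : ℝ} [hβ : Fact (IsPisot β)]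

/-! ### Approximation at the primes that divide `β` -/

theorem norm_algebraMap_lt_iff (v : HeightOneSpectrum (𝓞 (QBeta β))) (x y : QBeta β) :
    ‖algebraMap (QBeta β) (v.adicCompletion (QBeta β)) x‖ <
      ‖algebraMap (QBeta β) (v.adicCompletion (QBeta β)) y‖ ↔
      v.valuation (QBeta β) x < v.valuation (QBeta β) y := by
  rw [FinitePlace.norm_def, FinitePlace.norm_def, NNReal.coe_lt_coe,
    (WithZeroMulInt.toNNReal_strictMono (HeightOneSpectrum.one_lt_absNorm_nnreal v)).lt_iff_lt]
  exact iff_of_eq (congrArg₂ _ (HeightOneSpectrum.valuedAdicCompletion_eq_valuation' v x)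
    (HeightOneSpectrum.valuedAdicCompletion_eq_valuation' v y))

theorem norm_algebraMap_le_iff (v : HeightOneSpectrum (𝓞 (QBeta β))) (x y : QBeta β) :
    ‖algebraMap (QBeta β) (v.adicCompletion (QBeta β)) x‖ ≤
      ‖algebraMap (QBeta β) (v.adicCompletion (QBeta β)) y‖ ↔
      v.valuation (QBeta β) x ≤ v.valuation (QBeta β) y := by
  rw [← not_lt, ← not_lt, norm_algebraMap_lt_iff]

theorem norm_algebraMap_le_one_iff (v : HeightOneSpectrum (𝓞 (QBeta β))) (x : QBeta β) :
    ‖algebraMap (QBeta β) (v.adicCompletion (QBeta β)) x‖ ≤ 1 ↔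
      v.valuation (QBeta β) x ≤ 1 := by
  simpa using norm_algebraMap_le_iff v x 1

/-- Density gives a close element of the field, integral at `v` by the ultrametric inequality; it is
then replaced by a global integer close to it at `v`. -/
theorem exists_integer_close (v : HeightOneSpectrum (𝓞 (QBeta β))) {b : QBeta β} (hb : b ≠ 0)
    (z : v.adicCompletion (QBeta β)) (hz : ‖z‖ ≤ 1) :
    ∃ a : 𝓞 (QBeta β), ‖z - algebraMap (QBeta β) (v.adicCompletion (QBeta β)) a‖ ≤
      ‖algebraMap (QBeta β) (v.adicCompletion (QBeta β)) b‖ := by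
  set c := ‖algebraMap (QBeta β) (v.adicCompletion (QBeta β)) b‖
  have hc : 0 < c := norm_pos_iff.2 (by simpa using hb)
  have hd := HeightOneSpectrum.denseRange_algebraMap (QBeta β) v
  have ho : IsOpen {y : v.adicCompletion (QBeta β) | ‖z - y‖ < min c 1} :=
    isOpen_lt (by fun_prop) continuous_const
  obtain ⟨k, hk⟩ := hd.exists_mem_open ho ⟨z, by simpa using hc⟩
  have hk' : ‖z - algebraMap (QBeta β) (v.adicCompletion (QBeta β)) k‖ < min c 1 := hk
  have hk1 : ‖algebraMap (QBeta β) (v.adicCompletion (QBeta β)) k‖ ≤ 1 := by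
    have := norm_sub_le_max' z
      (z - algebraMap (QBeta β) (v.adicCompletion (QBeta β)) k)
    rw [sub_sub_cancel] at this
    exact this.trans (max_le hz (hk'.le.trans (min_le_right _ _)))
  obtain ⟨a, ha⟩ := HeightOneSpectrum.exists_valuation_sub_lt_of_integer v
    ((norm_algebraMap_le_one_iff v k).1 hk1)
    (Units.mk0 (v.valuation (QBeta β) b) ((Valuation.ne_zero_iff _).2 hb))
  have ha' := (norm_algebraMap_lt_iff v _ b).2 ha
  refine ⟨a, ?_⟩
  have := norm_sub_le_max'
    (z - algebraMap (QBeta β) (v.adicCompletion (QBeta β)) k)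
    (algebraMap (QBeta β) (v.adicCompletion (QBeta β)) (a - k))
  rw [map_sub, sub_sub_sub_cancel_right, ← map_sub] at this
  exact this.trans (max_le (hk'.le.trans (min_le_left _ _)) ha'.le)

theorem norm_canonicalEmbedding_snd_le_one (a : 𝓞 (QBeta β)) (p : PrimePlace β) :
    ‖(canonicalEmbedding β (a : QBeta β)).2 p‖ ≤ 1 :=
  (norm_algebraMap_le_one_iff p.1 _).2 (p.1.valuation_le_one a)

/-- Every integral adele at the primes that divide `β` is congruent to an integer modulo `β`. -/
theorem exists_integer_congr (z : ∀ p : PrimePlace β, p.1.adicCompletion (QBeta β))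
    (hz : ∀ p, ‖z p‖ ≤ 1) : ∃ a : 𝓞 (QBeta β), ∀ p,
      ‖z p - (canonicalEmbedding β (a : QBeta β)).2 p‖ ≤ ‖(canonicalEmbedding β (gen β)).2 p‖ := by
  classical
  have := Fintype.ofFinite (PrimePlace β)
  have hex : ∀ p : PrimePlace β, ∃ a : 𝓞 (QBeta β),
      ‖z p - algebraMap (QBeta β) (p.1.adicCompletion (QBeta β)) a‖ ≤
        ‖algebraMap (QBeta β) (p.1.adicCompletion (QBeta β)) (gen β)‖ :=
    fun p => exists_integer_close p.1 (gen_ne_zero β) (z p) (hz p)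
  choose a ha using hex
  -- Chinese remainder theorem. The exponent of each prime is its multiplicity in `(β)`, so the
  -- congruence says that the error is at most `|β|` at that prime.
  obtain ⟨y, hy⟩ := IsDedekindDomain.exists_forall_sub_mem_ideal (s := Finset.univ)
    (fun p : PrimePlace β => p.1.asIdeal)
    (fun p => multiplicity p.1.asIdeal (Ideal.span {genInt β})) (fun p _ => p.1.prime)
    (fun p _ q _ hpq h => hpq (Subtype.ext (HeightOneSpectrum.ext h))) fun p => a p.1
  refine ⟨y, fun p => ?_⟩
  have h1 := hy p (Finset.mem_univ p)
  rw [← HeightOneSpectrum.intValuation_le_pow_iff_mem,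
    ← HeightOneSpectrum.intValuation_eq_exp_neg_multiplicity _ (genInt_ne_zero β),
    ← HeightOneSpectrum.valuation_of_algebraMap (K := QBeta β),
    ← HeightOneSpectrum.valuation_of_algebraMap (K := QBeta β), ← norm_algebraMap_le_iff] at h1
  have h3 : ‖algebraMap (QBeta β) (p.1.adicCompletion (QBeta β)) (y : QBeta β) -
      algebraMap (QBeta β) (p.1.adicCompletion (QBeta β)) (a p : QBeta β)‖ ≤
        ‖algebraMap (QBeta β) (p.1.adicCompletion (QBeta β)) (gen β)‖ := by
    rw [← map_sub]
    exact h1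
  have h2 := (norm_sub_le_max' _ _).trans (max_le (ha p) h3)
  rw [sub_sub_sub_cancel_right] at h2
  exact h2

/-! ### Haar measure on the finite part -/

/-- The box with the given radii in the finite part of the representation space. -/
def finiteBox (β : ℝ) [Fact (IsPisot β)] (r : PrimePlace β → ℝ) :
    Set (∀ p : PrimePlace β, p.1.adicCompletion (QBeta β)) := {z | ∀ p, ‖z p‖ ≤ r p}

theorem card_quotient_span_genInt :
    (Nat.card (𝓞 (QBeta β) ⧸ Ideal.span {genInt β}) : ℝ) = |(Algebra.norm ℚ (gen β) : ℚ)| := by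
  rw [← Submodule.cardQuot_apply, ← Ideal.absNorm_apply, Ideal.absNorm_span_singleton,
    ← coe_genInt, ← Algebra.coe_norm_int]
  push_cast
  rw [Nat.cast_natAbs, Int.cast_abs]

theorem card_quotient_ne_zero : Nat.card (𝓞 (QBeta β) ⧸ Ideal.span {genInt β}) ≠ 0 := by
  have h := card_quotient_span_genInt (β := β)
  intro h0
  rw [h0, Nat.cast_zero, eq_comm] at h
  have h1 : Algebra.norm ℚ (gen β) = 0 := by exact_mod_cast abs_eq_zero.1 (by exact_mod_cast h)
  exact gen_ne_zero β (Algebra.norm_eq_zero_iff.1 h1)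

/-- By `exists_integer_congr`, representatives of the integers modulo `β` translate the `β`-box so
as to cover the unit box. Only a covering is needed, as the opposite bound on the modulus comes from
packing. -/
theorem measure_finiteBox_one_le
    [MeasurableSpace (∀ p : PrimePlace β, p.1.adicCompletion (QBeta β))]
    [BorelSpace (∀ p : PrimePlace β, p.1.adicCompletion (QBeta β))]
    (μ : Measure (∀ p : PrimePlace β, p.1.adicCompletion (QBeta β))) [μ.IsAddHaarMeasure] :
    μ (finiteBox β fun _ => 1) ≤ Nat.card (𝓞 (QBeta β) ⧸ Ideal.span {genInt β}) *
      μ (finiteBox β fun p => ‖(canonicalEmbedding β (gen β)).2 p‖) := by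
  have : Finite (𝓞 (QBeta β) ⧸ Ideal.span {genInt β}) :=
    Nat.finite_of_card_ne_zero card_quotient_ne_zero
  have := Fintype.ofFinite (𝓞 (QBeta β) ⧸ Ideal.span {genInt β})
  set S := finiteBox β fun p => ‖(canonicalEmbedding β (gen β)).2 p‖ with hS
  have hcover : finiteBox β (fun _ => 1) ⊆ ⋃ q : 𝓞 (QBeta β) ⧸ Ideal.span {genInt β},
      (fun z => z + -(canonicalEmbedding β (q.out : QBeta β)).2) ⁻¹' S := by
    intro z hz
    obtain ⟨a, ha⟩ := exists_integer_congr z hz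
    refine Set.mem_iUnion.2 ⟨Ideal.Quotient.mk _ a, fun p => ?_⟩
    have h1 : a - (Ideal.Quotient.mk (Ideal.span {genInt β}) a).out ∈ Ideal.span {genInt β} := by
      rw [← Ideal.Quotient.eq]; exact (Quotient.out_eq' _).symm
    obtain ⟨c, hc⟩ := Ideal.mem_span_singleton.1 h1
    set r := (Ideal.Quotient.mk (Ideal.span {genInt β}) a).out
    have h2 : (canonicalEmbedding β (a : QBeta β)).2 p - (canonicalEmbedding β (r : QBeta β)).2 p =
        (canonicalEmbedding β (gen β)).2 p * (canonicalEmbedding β (c : QBeta β)).2 p := by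
      have h3 := congrArg (fun x : 𝓞 (QBeta β) => (canonicalEmbedding β (x : QBeta β)).2 p) hc
      simp only [map_sub, map_mul] at h3
      exact h3
    have h4 : ‖(canonicalEmbedding β (a : QBeta β)).2 p -
        (canonicalEmbedding β (r : QBeta β)).2 p‖ ≤ ‖(canonicalEmbedding β (gen β)).2 p‖ := by
      rw [h2, norm_mul]
      exact mul_le_of_le_one_right (norm_nonneg _) (norm_canonicalEmbedding_snd_le_one c p)
    have h5 := IsUltrametricDist.norm_add_le_max
      (z p - (canonicalEmbedding β (a : QBeta β)).2 p)
      ((canonicalEmbedding β (a : QBeta β)).2 p - (canonicalEmbedding β (r : QBeta β)).2 p)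
    rw [sub_add_sub_cancel] at h5
    have h6 := h5.trans (max_le (ha p) h4)
    change ‖z p + -(canonicalEmbedding β (r : QBeta β)).2 p‖ ≤ _
    rwa [← sub_eq_add_neg]
  calc μ (finiteBox β fun _ => 1) ≤ _ := measure_mono hcover
    _ ≤ ∑ q : 𝓞 (QBeta β) ⧸ Ideal.span {genInt β},
        μ ((fun z => z + -(canonicalEmbedding β (q.out : QBeta β)).2) ⁻¹' S) :=
      measure_iUnion_fintype_le _ _
    _ = _ := by
      simp only [measure_preimage_add_right]
      rw [Finset.sum_const, Finset.card_univ, Nat.card_eq_fintype_card, nsmul_eq_mul]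

end

section

variable (β : ℝ) [hβ : Fact (IsPisot β)]

/-! ### The modulus of the multiplication by `β` -/

instance secondCountable_adicCompletion (p : PrimePlace β) :
    SecondCountableTopology (p.1.adicCompletion (QBeta β)) := by
  have := properSpace_adicCompletion β p.1
  infer_instance

instance secondCountable_repSpace : SecondCountableTopology (RepSpace β) :=
  inferInstanceAs (SecondCountableTopology
    ((∀ v : ArchPlace β, v.1.Completion) × (∀ v : PrimePlace β, v.1.adicCompletion (QBeta β))))

/-- The multiplication by `δ_β(β)` as an automorphism of the representation space. -/
def mulGen : RepSpace β ≃ₜ+ RepSpace β :=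
  ContinuousAddEquiv.mulLeft
    (Units.map (canonicalEmbedding β : QBeta β →* RepSpace β) (Units.mk0 _ (gen_ne_zero β)))

theorem mulGen_apply (x : RepSpace β) : mulGen β x = canonicalEmbedding β (gen β) * x := rfl

/-- The factor by which the multiplication by `δ_β(β)` scales Haar measures. -/
def modulus : NNReal := addEquivAddHaarChar (mulGen β)

variable {β}

theorem measure_mulGen_image (μ : Measure (RepSpace β)) [μ.IsAddHaarMeasure]
    (S : Set (RepSpace β)) : μ (mulGen β '' S) = modulus β * μ S := by
  rw [← addEquivAddHaarChar_smul_preimage μ (mulGen β), Set.preimage_image_eq _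
    (mulGen β).injective]
  rfl

variable (β) in
/-- The box with the given radii in the representation space. -/
def repBox (r : ArchPlace β → ℝ) (t : PrimePlace β → ℝ) : Set (RepSpace β) :=
  {x | (∀ v, ‖x.1 v‖ ≤ r v) ∧ ∀ p, ‖x.2 p‖ ≤ t p}

theorem preimage_mulGen_repBox :
    mulGen β ⁻¹' repBox β (fun v => ‖(canonicalEmbedding β (gen β)).1 v‖)
      (fun p => ‖(canonicalEmbedding β (gen β)).2 p‖) = repBox β (fun _ => 1) fun _ => 1 := by
  ext x
  refine and_congr (forall_congr' fun v => ?_) (forall_congr' fun p => ?_)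
  · change ‖(canonicalEmbedding β (gen β)).1 v * x.1 v‖ ≤ _ ↔ _
    rw [norm_mul]
    exact mul_le_iff_le_one_right (norm_pos_iff.2 (canonicalEmbedding_fst_ne_zero (gen_ne_zero β) v))
  · change ‖(canonicalEmbedding β (gen β)).2 p * x.2 p‖ ≤ _ ↔ _
    rw [norm_mul]
    exact mul_le_iff_le_one_right (norm_pos_iff.2 (canonicalEmbedding_snd_ne_zero (gen_ne_zero β) p))

theorem repBox_eq_prod (r : ArchPlace β → ℝ) (t : PrimePlace β → ℝ) :
    repBox β r t = (Set.univ.pi fun v => Metric.closedBall 0 (r v)) ×ˢ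
      (Set.univ.pi fun p => Metric.closedBall 0 (t p)) := by
  ext x
  change _ ↔ x.1 ∈ _ ∧ x.2 ∈ _
  simp only [repBox, Set.mem_ofPred_eq, Set.mem_univ_pi, mem_closedBall_zero_iff]

theorem isCompact_repBox (r : ArchPlace β → ℝ) (t : PrimePlace β → ℝ) :
    IsCompact (repBox β r t) := by
  have h2 : ∀ p : PrimePlace β, ProperSpace (p.1.adicCompletion (QBeta β)) :=
    fun p => properSpace_adicCompletion β p.1
  rw [repBox_eq_prod]
  exact (isCompact_univ_pi fun v => isCompact_closedBall _ _).prod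
    (isCompact_univ_pi fun p => isCompact_closedBall _ _)

theorem repBox_mem_nhds {r : ArchPlace β → ℝ} {t : PrimePlace β → ℝ} (hr : ∀ v, 0 < r v)
    (ht : ∀ p, 0 < t p) : repBox β r t ∈ nhds (0 : RepSpace β) := by
  rw [repBox_eq_prod]
  exact prod_mem_nhds
    (set_pi_mem_nhds Set.finite_univ fun v _ => Metric.closedBall_mem_nhds 0 (hr v))
    (set_pi_mem_nhds Set.finite_univ fun p _ => Metric.closedBall_mem_nhds 0 (ht p))

/-- For a product Haar measure, the Archimedean factors scale by `|β|_v` to the multiplicity and the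
finite part costs at most `|N(β)|` translates; `prod_archPlace` leaves the factor `β`. One measure
suffices, since the modulus is the same for all Haar measures. -/
theorem exists_haar_repSpace : ∃ μ : Measure (RepSpace β), μ.IsAddHaarMeasure ∧
    μ (repBox β (fun _ => 1) fun _ => 1) ≤ ENNReal.ofReal β *
      μ (repBox β (fun v => ‖(canonicalEmbedding β (gen β)).1 v‖)
        fun p => ‖(canonicalEmbedding β (gen β)).2 p‖) := by
  classical
  let A := ∀ v : ArchPlace β, v.1.Completion
  let F := ∀ p : PrimePlace β, p.1.adicCompletion (QBeta β)
  let _ (v : ArchPlace β) : MeasurableSpace v.1.Completion := borel _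
  have (v : ArchPlace β) : BorelSpace v.1.Completion := ⟨rfl⟩
  let _ : MeasurableSpace F := borel F
  have : BorelSpace F := ⟨rfl⟩
  have : LocallyCompactSpace F := by
    have := fun p : PrimePlace β => properSpace_adicCompletion β p.1
    infer_instance
  choose m hm hball using fun v : ArchPlace β => exists_haar_completion v.1
  let f : Measure F := Measure.addHaar
  let μ₀ : Measure (A × F) := (Measure.pi m).prod f
  let e : A × F ≃+ RepSpace β := AddEquiv.refl (A × F)
  have hec : Continuous e := continuous_id
  have hec' : Continuous e.symm := continuous_id
  have hbox : ∀ r t, (μ₀.map e) (repBox β r t) =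
      (∏ v, m v (Metric.closedBall 0 (r v))) * f (finiteBox β t) := by
    intro r t
    have h : e ⁻¹' (repBox β r t) =
        (Set.univ.pi fun v => Metric.closedBall 0 (r v)) ×ˢ finiteBox β t := by
      ext x
      simp only [Set.mem_prod, Set.mem_univ_pi, mem_closedBall_zero_iff]
      rfl
    rw [Measure.map_apply hec.measurable (isCompact_repBox r t).isClosed.measurableSet, h,
      Measure.prod_prod, Measure.pi_pi]
  refine ⟨μ₀.map e, e.isAddHaarMeasure_map μ₀ hec hec', ?_⟩
  rw [hbox, hbox]
  simp only [hball _ _ (norm_nonneg _)]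
  rw [Finset.prod_mul_distrib]
  set c := ∏ v, m v (Metric.closedBall 0 1)
  have h1 := measure_finiteBox_one_le (β := β) f
  set N := Nat.card (𝓞 (QBeta β) ⧸ Ideal.span {genInt β})
  have h2 : ENNReal.ofReal β * ∏ v : ArchPlace β,
      ENNReal.ofReal (‖(canonicalEmbedding β (gen β)).1 v‖ ^ v.1.mult) = N := by
    rw [← ENNReal.ofReal_prod_of_nonneg (fun v _ => by positivity),
      ← ENNReal.ofReal_mul (beta_pos β).le, ← ENNReal.ofReal_natCast, card_quotient_span_genInt]
    simp only [norm_canonicalEmbedding_fst]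
    rw [prod_archPlace]
  calc c * f (finiteBox β fun _ => 1) ≤ c * (N * f (finiteBox β fun p =>
        ‖(canonicalEmbedding β (gen β)).2 p‖)) := by gcongr
    _ = _ := by rw [← h2]; ring

/-- The multiplication by `δ_β(β)` scales Haar measures by at least `1 / β`. -/
theorem one_le_mul_modulus : 1 ≤ ENNReal.ofReal β * modulus β := by
  obtain ⟨μ, hμ, hle⟩ := exists_haar_repSpace (β := β)
  have h1 := addEquivAddHaarChar_smul_preimage μ (mulGen β)
    (X := repBox β (fun v => ‖(canonicalEmbedding β (gen β)).1 v‖)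
      fun p => ‖(canonicalEmbedding β (gen β)).2 p‖)
  rw [preimage_mulGen_repBox] at h1
  rw [← h1] at hle
  change _ ≤ _ * ((modulus β : ENNReal) * _) at hle
  rw [← mul_assoc] at hle
  set B := μ (repBox β (fun _ => 1) fun _ => 1)
  have hB0 : B ≠ 0 := (Measure.measure_pos_of_mem_nhds μ
    (repBox_mem_nhds (fun _ => one_pos) fun _ => one_pos)).ne'
  have hB1 : B ≠ ⊤ := (isCompact_repBox _ _).measure_lt_top.ne
  by_contra! hlt
  have := ENNReal.mul_lt_mul_left hB0 hB1 hlt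
  rw [one_mul] at this
  exact absurd hle (not_le.2 this)

end

section

variable {β : ℝ}

/-! ### Integral parts of greedy expansions -/

theorem iterate_betaMap_mem {x : ℝ} (hx : x ∈ Set.Ico (0 : ℝ) 1) (n : ℕ) :
    (betaMap β)^[n] x ∈ Set.Ico (0 : ℝ) 1 := by
  cases n with
  | zero => exact hx
  | succ n =>
    rw [Function.iterate_succ_apply']
    exact ⟨betaMap_nonneg _ _, betaMap_lt_one _ _⟩

variable [hβ : Fact (IsPisot β)]

/-- The integer with greedy expansion `⌊β x⌋ … ⌊β T^{n-1} x⌋`. -/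
def greedyInt (β : ℝ) [Fact (IsPisot β)] (x : ℝ) : ℕ → 𝓞 (QBeta β)
  | 0 => 0
  | n + 1 => genInt β * greedyInt β x n + (⌊β * (betaMap β)^[n] x⌋₊ : 𝓞 (QBeta β))

theorem greedyInt_succ (x : ℝ) (n : ℕ) : (greedyInt β x (n + 1) : QBeta β) =
    gen β * (greedyInt β x n : QBeta β) + (⌊β * (betaMap β)^[n] x⌋₊ : QBeta β) := by
  rw [greedyInt]
  push_cast
  rfl

theorem coe_greedyInt {x : ℝ} (hx : x ∈ Set.Ico (0 : ℝ) 1) (n : ℕ) :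
    (((greedyInt β x n : QBeta β)) : ℝ) = β ^ n * x - (betaMap β)^[n] x := by
  induction n with
  | zero => simp [greedyInt]
  | succ n ih =>
    have h := betaMap_eq (beta_pos β) (iterate_betaMap_mem (β := β) hx n).1
    rw [Function.iterate_succ_apply', h, greedyInt_succ]
    push_cast
    rw [ih, coe_gen]
    ring

/-- The greedy remainder stays strictly below the state, so the greedy digits can be read from `1`.
-/
theorem iterate_betaMap_lt_run {x : ℝ} (hx : x ∈ Set.Ico (0 : ℝ) 1) (n : ℕ) :
    (betaMap β)^[n] x < runFrom β 1 (fun n => ⌊β * (betaMap β)^[n] x⌋₊) n := by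
  induction n with
  | zero => exact hx.2
  | succ n ih =>
    refine lt_min (iterate_betaMap_mem hx (n + 1)).2 ?_
    rw [Function.iterate_succ_apply', betaMap_eq (beta_pos β) (iterate_betaMap_mem (β := β) hx n).1]
    linarith [mul_lt_mul_of_pos_left ih (beta_pos β)]

theorem zero_mem_rauzyPiece {s : State β} (hs : s.val = 1) : (0 : RepSpace β) ∈ rauzyPiece β s := by
  refine ⟨fun _ => 0, fun _ => s, rfl, fun _ => ?_, ?_⟩
  · have hb := one_lt_beta β
    rw [edge_iff hb, hs, stateStep]
    norm_num
    exact ⟨beta_pos β, hb.le⟩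
  · simp [rep]

/-- The past consists of the greedy digits, the last one at index `0`, preceded by zeros in the
state `1`. Each new digit is one affine map along an arrow. -/
theorem canonicalEmbedding_greedyInt_mem {x : ℝ} (hx : x ∈ Set.Ico (0 : ℝ) 1) (n : ℕ) :
    canonicalEmbedding β (greedyInt β x n : QBeta β) ∈ rauzy β := by
  have hb := one_lt_beta β
  set f := fun n => ⌊β * (betaMap β)^[n] x⌋₊ with hf
  have hpos : ∀ n, 0 < β * runFrom β 1 f n - f n := fun n => by
    have h1 := mul_lt_mul_of_pos_left (iterate_betaMap_lt_run (β := β) hx n) (beta_pos β)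
    have h2 := Nat.floor_le (mul_nonneg (beta_pos β).le (iterate_betaMap_mem (β := β) hx n).1)
    exact sub_pos.2 (h2.trans_lt h1)
  have key : ∀ n, ∀ s : State β, s.val = runFrom β 1 f n →
      canonicalEmbedding β (greedyInt β x n : QBeta β) ∈ rauzyPiece β s := by
    intro n
    induction n with
    | zero =>
      intro s hs
      simpa [greedyInt] using zero_mem_rauzyPiece hs
    | succ n ih =>
      intro s hs
      obtain ⟨p, hp⟩ := State.exists_val_eq hb
        (runFrom_mem_range (beta_pos β) (one_mem_range β) n fun j _ => hpos j)
      have he : Edge β p (f n) s := (edge_iff hb _ _ _).2 ⟨hp ▸ hpos n, by rw [hs, hp]; rfl⟩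
      rw [rauzyPiece_eq]
      refine Set.mem_iUnion.2 ⟨⟨⟨(p, f n, s), he⟩, rfl⟩, _, ih p hp, ?_⟩
      rw [affineMap, greedyInt_succ, map_add, map_mul]
  obtain ⟨s, hs⟩ := State.exists_val_eq hb
    (runFrom_mem_range (beta_pos β) (one_mem_range β) n fun j _ => hpos j)
  rw [rauzy_eq_iUnion]
  exact Set.mem_iUnion.2 ⟨s, key n s hs⟩

variable (β) in
/-- The element of `ℤ[β]` with a greedy expansion of length `n` that is closest to `j` from
below. -/
def floorInt (n j : ℕ) : 𝓞 (QBeta β) := greedyInt β (j / β ^ n) n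

theorem div_pow_mem {n j : ℕ} (hj : (j : ℝ) < β ^ n) : (j : ℝ) / β ^ n ∈ Set.Ico (0 : ℝ) 1 := by
  have := pow_pos (beta_pos β) n
  exact ⟨by positivity, (div_lt_one this).2 hj⟩

theorem coe_floorInt {n j : ℕ} (hj : (j : ℝ) < β ^ n) : ∃ r ∈ Set.Ico (0 : ℝ) 1,
    ((floorInt β n j : QBeta β) : ℝ) = j - r ∧ 0 ≤ j - r := by
  have hp := pow_pos (beta_pos β) n
  have h1 := coe_greedyInt (β := β) (div_pow_mem hj) n
  rw [mul_div_cancel₀ _ hp.ne'] at h1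
  refine ⟨_, iterate_betaMap_mem (β := β) (div_pow_mem hj) n, h1, ?_⟩
  rw [← h1]
  have h2 : ∀ x, ∀ n, 0 ≤ ((greedyInt β x n : QBeta β) : ℝ) := by
    intro x n
    induction n with
    | zero => simp [greedyInt]
    | succ n ih =>
      rw [greedyInt_succ]
      push_cast
      rw [coe_gen]
      have := beta_pos β
      positivity
  exact h2 _ _

theorem abs_floorInt_sub_lt {n i j : ℕ} (hi : (i : ℝ) < β ^ n) (hj : (j : ℝ) < β ^ n) :
    |((floorInt β n i : QBeta β) : ℝ) - ((floorInt β n j : QBeta β) : ℝ)| < β ^ n := by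
  obtain ⟨r, hr, h1, h2⟩ := coe_floorInt hi
  obtain ⟨r', hr', h3, h4⟩ := coe_floorInt hj
  rw [h1, h3, abs_sub_lt_iff]
  constructor <;> linarith [hr.1, hr'.1]

/-- The real value of `floorInt β n j` lies in `(j - 1, j]`, and these intervals are disjoint. -/
theorem floorInt_injOn (n : ℕ) : Set.InjOn (floorInt β n) {j | (j : ℝ) < β ^ n} := by
  intro i hi j hj h
  obtain ⟨r, hr, h1, -⟩ := coe_floorInt hi
  obtain ⟨r', hr', h2, -⟩ := coe_floorInt hj
  rw [h, h2] at h1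
  have h3 : (i : ℝ) < j + 1 := by linarith [hr.2, hr'.1]
  have h4 : (j : ℝ) < i + 1 := by linarith [hr'.2, hr.1]
  have h5 : i < j + 1 := by exact_mod_cast h3
  have h6 : j < i + 1 := by exact_mod_cast h4
  omega

/-! ### Separation of integers -/

variable (β) in
/-- The box of radius `1 / 3` in the representation space. -/
def smallBox : Set (RepSpace β) := repBox β (fun _ => 1 / 3) fun _ => 1 / 3

/-- A non-zero integer divided by a power of `β` is large at the standard place or in `K_β`. -/
theorem eq_zero_of_mem_smallBox {a : 𝓞 (QBeta β)} {n : ℕ} (ha : |((a : QBeta β) : ℝ)| < β ^ n)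
    {x y : RepSpace β} (hx : x ∈ smallBox β) (hy : y ∈ smallBox β)
    (hxy : canonicalEmbedding β (a : QBeta β) = canonicalEmbedding β (gen β) ^ n * (x - y)) :
    a = 0 := by
  by_contra hne
  have hg := gen_ne_zero β
  set c : QBeta β := a / gen β ^ n with hc
  have hcx : canonicalEmbedding β c = x - y := by
    have h1 : canonicalEmbedding β (gen β ^ n * c) = canonicalEmbedding β (gen β ^ n) * (x - y) := by
      rw [hc, mul_div_cancel₀ _ (pow_ne_zero n hg), map_pow]; exact hxy
    rw [map_mul] at h1
    have h2 := congrArg (fun z => canonicalEmbedding β (gen β ^ n)⁻¹ * z) h1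
    simpa only [← mul_assoc, ← map_mul, inv_mul_cancel₀ (pow_ne_zero n hg), map_one, one_mul]
      using h2
  -- At primes dividing `β`, `c` is a difference of two small elements, hence integral; at the other
  -- primes `β` is a unit.
  have hint : c ∈ (algebraMap (𝓞 (QBeta β)) (QBeta β)).range := by
    refine HeightOneSpectrum.mem_integers_of_valuation_le_one (QBeta β) c fun v => ?_
    by_cases hv : v.valuation (QBeta β) (gen β) < 1
    · rw [← norm_algebraMap_le_one_iff]
      change ‖(canonicalEmbedding β c).2 ⟨v, hv⟩‖ ≤ 1
      rw [hcx]
      refine (norm_sub_le_max' _ _).trans (max_le ((hx.2 _).trans ?_) ((hy.2 _).trans ?_)) <;>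
        norm_num
    · have h1 : v.valuation (QBeta β) (gen β) = 1 :=
        le_antisymm (v.valuation_le_one (genInt β)) (not_lt.1 hv)
      rw [hc, map_div₀, map_pow, h1, one_pow, div_one]
      exact v.valuation_le_one a
  obtain ⟨b, hb⟩ := hint
  have hb0 : b ≠ 0 := by
    rintro rfl
    rw [map_zero, eq_comm, hc, div_eq_zero_iff] at hb
    rcases hb with hb | hb
    · exact hne (by exact_mod_cast hb)
    · exact pow_ne_zero n hg hb
  -- The radius `1 / 3` makes `|c| ≤ 2 / 3` at every non-standard Archimedean place. A non-zero
  -- integer must then have absolute value at least `1` at the standard place, against `|a| < β ^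
  -- n`.
  have h1 := InfinitePlace.one_le_of_lt_one (w := stdPlace β) hb0 fun w hw => by
    have h2 := norm_canonicalEmbedding_fst c ⟨w, place_gen_lt_one hw⟩
    rw [hcx] at h2
    change w (algebraMap (𝓞 (QBeta β)) (QBeta β) b) < 1
    rw [hb]
    change _ = w c at h2
    rw [← h2]
    have h3 := norm_sub_le (x.1 ⟨w, place_gen_lt_one hw⟩) (y.1 ⟨w, place_gen_lt_one hw⟩)
    have h4 := hx.1 ⟨w, place_gen_lt_one hw⟩
    have h5 := hy.1 ⟨w, place_gen_lt_one hw⟩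
    change ‖x.1 ⟨w, place_gen_lt_one hw⟩ - y.1 ⟨w, place_gen_lt_one hw⟩‖ < 1
    linarith
  change 1 ≤ stdPlace β (algebraMap (𝓞 (QBeta β)) (QBeta β) b) at h1
  rw [hb, stdPlace_apply, hc] at h1
  have hp := pow_pos (beta_pos β) n
  push_cast at h1
  rw [coe_gen, abs_div, abs_of_pos hp, one_le_div hp] at h1
  exact absurd ha (not_lt.2 h1)

/-! ### Positive measure -/

theorem iterate_mulGen (n : ℕ) (x : RepSpace β) :
    (mulGen β)^[n] x = canonicalEmbedding β (gen β) ^ n * x := by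
  induction n with
  | zero => simp
  | succ n ih => rw [Function.iterate_succ_apply', ih, mulGen_apply, pow_succ', mul_assoc]

theorem measure_iterate_mulGen_image (μ : Measure (RepSpace β)) [μ.IsAddHaarMeasure] (n : ℕ)
    (S : Set (RepSpace β)) : μ ((mulGen β)^[n] '' S) = modulus β ^ n * μ S := by
  induction n with
  | zero => simp
  | succ n ih =>
    rw [Function.iterate_succ', Set.image_comp, measure_mulGen_image, ih, pow_succ', mul_assoc]

/-- The disjoint translates at the integers with greedy expansions of length `n`. -/
theorem le_measure_rauzy_add (μ : Measure (RepSpace β)) [μ.IsAddHaarMeasure] (n : ℕ) :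
    (ENNReal.ofReal β * modulus β) ^ n * μ (smallBox β) ≤
      μ (rauzy β + (mulGen β)^[n] '' smallBox β) := by
  set S := (mulGen β)^[n] '' smallBox β with hS
  set M := ⌈β ^ n⌉₊
  have hlt : ∀ j ∈ Finset.range M, (j : ℝ) < β ^ n := fun j hj => Nat.lt_ceil.1 (by simpa using hj)
  have hsub : ⋃ j ∈ Finset.range M, (canonicalEmbedding β (floorInt β n j : QBeta β) +ᵥ S) ⊆
      rauzy β + S := by
    refine Set.iUnion₂_subset fun j hj => ?_
    rintro _ ⟨z, hz, rfl⟩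
    exact Set.add_mem_add (canonicalEmbedding_greedyInt_mem (div_pow_mem (hlt j hj)) n) hz
  have hdisj : Set.PairwiseDisjoint (Finset.range M : Set ℕ)
      fun j => canonicalEmbedding β (floorInt β n j : QBeta β) +ᵥ S := by
    intro i hi j hj hij
    refine Set.disjoint_left.2 ?_
    rintro _ ⟨_, ⟨x, hx, rfl⟩, rfl⟩ ⟨_, ⟨y, hy, rfl⟩, h⟩
    refine hij (floorInt_injOn n (hlt i hi) (hlt j hj) ?_)
    simp only [vadd_eq_add, iterate_mulGen] at h
    refine sub_eq_zero.1 (eq_zero_of_mem_smallBox (n := n) ?_ hy hx ?_)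
    · exact abs_floorInt_sub_lt (hlt i hi) (hlt j hj)
    · have h1 : ((floorInt β n i - floorInt β n j : 𝓞 (QBeta β)) : QBeta β) =
          (floorInt β n i : QBeta β) - (floorInt β n j : QBeta β) := rfl
      rw [h1, map_sub, mul_sub]
      linear_combination -h
  have hmeas : ∀ j ∈ Finset.range M,
      MeasurableSet (canonicalEmbedding β (floorInt β n j : QBeta β) +ᵥ S) := fun j _ =>
    (((isCompact_repBox _ _).image ((mulGen β).continuous.iterate n)).vadd _).isClosed.measurableSet
  refine le_trans ?_ (measure_mono hsub)
  rw [measure_biUnion_finset hdisj hmeas]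
  simp only [measure_vadd]
  rw [Finset.sum_const, Finset.card_range, nsmul_eq_mul, hS, measure_iterate_mulGen_image,
    mul_pow, mul_assoc]
  gcongr
  rw [← ENNReal.ofReal_pow (beta_pos β).le, ← ENNReal.ofReal_natCast]
  exact ENNReal.ofReal_le_ofReal (Nat.le_ceil _)

theorem smallBox_mem_nhds : smallBox β ∈ nhds (0 : RepSpace β) :=
  repBox_mem_nhds (fun _ => by norm_num) fun _ => by norm_num

theorem iterate_mulGen_image_subset (n : ℕ) : (mulGen β)^[n] '' smallBox β ⊆ smallBox β := by
  rintro _ ⟨x, hx, rfl⟩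
  induction n with
  | zero => exact hx
  | succ n ih =>
    rw [Function.iterate_succ_apply', mulGen_apply]
    refine ⟨fun v => ?_, fun p => ?_⟩
    · change ‖(canonicalEmbedding β (gen β)).1 v * _‖ ≤ _
      rw [norm_mul]
      exact (mul_le_of_le_one_left (norm_nonneg _)
        (norm_canonicalEmbedding_fst_lt_one v).le).trans (ih.1 v)
    · change ‖(canonicalEmbedding β (gen β)).2 p * _‖ ≤ _
      rw [norm_mul]
      exact (mul_le_of_le_one_left (norm_nonneg _)
        (norm_canonicalEmbedding_snd_lt_one p).le).trans (ih.2 p)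

theorem exists_prod_subset_of_mem_nhds_zero {E F : Type*} [SeminormedAddCommGroup E]
    [SeminormedAddCommGroup F] {W : Set (E × F)} (hW : W ∈ nhds 0) :
    ∃ ε > 0, ∀ (a : E) (b : F), ‖a‖ < ε → ‖b‖ < ε → (a, b) ∈ W := by
  obtain ⟨ε, hε, h⟩ := Metric.mem_nhds_iff.1 hW
  exact ⟨ε, hε, fun a b ha hb => h (mem_ball_zero_iff.2 (max_lt ha hb))⟩

theorem exists_iterate_mulGen_image_subset {W : Set (RepSpace β)} (hW : W ∈ nhds 0) :
    ∃ n, (mulGen β)^[n] '' smallBox β ⊆ W := by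
  have := Fintype.ofFinite (PrimePlace β)
  obtain ⟨ε, hε, hball⟩ := exists_prod_subset_of_mem_nhds_zero
    (E := ∀ v : ArchPlace β, v.1.Completion)
    (F := ∀ v : PrimePlace β, v.1.adicCompletion (QBeta β)) hW
  have h1 : ∀ᶠ n in atTop, ∀ v : ArchPlace β, ‖(canonicalEmbedding β (gen β)).1 v‖ ^ n < ε :=
    eventually_all.2 fun v => (tendsto_pow_atTop_nhds_zero_of_lt_one (norm_nonneg _)
      (norm_canonicalEmbedding_fst_lt_one v)).eventually_lt_const hε
  have h2 : ∀ᶠ n in atTop, ∀ v : PrimePlace β, ‖(canonicalEmbedding β (gen β)).2 v‖ ^ n < ε :=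
    eventually_all.2 fun v => (tendsto_pow_atTop_nhds_zero_of_lt_one (norm_nonneg _)
      (norm_canonicalEmbedding_snd_lt_one v)).eventually_lt_const hε
  obtain ⟨n, hn1, hn2⟩ := (h1.and h2).exists
  refine ⟨n, ?_⟩
  rintro _ ⟨x, hx, rfl⟩
  rw [iterate_mulGen]
  refine hball _ _ ((pi_norm_lt_iff hε).2 fun v => ?_) ((pi_norm_lt_iff hε).2 fun p => ?_)
  · change ‖(canonicalEmbedding β (gen β)).1 v ^ n * x.1 v‖ < ε
    rw [norm_mul, norm_pow]
    exact (mul_le_of_le_one_right (by positivity)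
      ((hx.1 v).trans (by norm_num))).trans_lt (hn1 v)
  · change ‖(canonicalEmbedding β (gen β)).2 p ^ n * x.2 p‖ < ε
    rw [norm_mul, norm_pow]
    exact (mul_le_of_le_one_right (by positivity)
      ((hx.2 p).trans (by norm_num))).trans_lt (hn2 p)

/-- The multiplication by `δ_β(β)` scales Haar measures by `1 / β`. -/
theorem mul_modulus_eq_one : ENNReal.ofReal β * modulus β = 1 := by
  refine le_antisymm ?_ one_le_mul_modulus
  by_contra! hlt
  let μ : Measure (RepSpace β) := Measure.addHaar
  have hfin : μ (rauzy β + smallBox β) ≠ ⊤ :=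
    (isCompact_rauzy.add (isCompact_repBox _ _)).measure_lt_top.ne
  have hpos : μ (smallBox β) ≠ 0 := (Measure.measure_pos_of_mem_nhds μ smallBox_mem_nhds).ne'
  -- All the packings lie in one compact set, while a factor larger than `1` would make their
  -- measures diverge.
  have hle : ∀ n, (ENNReal.ofReal β * modulus β) ^ n * μ (smallBox β) ≤
      μ (rauzy β + smallBox β) := fun n => (le_measure_rauzy_add μ n).trans
    (measure_mono (Set.add_subset_add_left (iterate_mulGen_image_subset n)))
  have h1 := (ENNReal.tendsto_pow_atTop_nhds_top_iff.2 hlt)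
  have h2 := ENNReal.Tendsto.mul_const h1 (b := μ (smallBox β)) (.inl (by simp))
  rw [ENNReal.top_mul hpos] at h2
  exact hfin (top_le_iff.1 (le_of_tendsto' h2 hle))

/-- With the modulus equal to `1 / β`, each neighbourhood `R_β + βⁿ · box` has measure at least that
of the box. These neighbourhoods shrink to the compact set `R_β`, so outer regularity passes the
bound to `R_β` itself. -/
theorem measure_rauzy_pos (μ : Measure (RepSpace β)) [μ.IsAddHaarMeasure] : 0 < μ (rauzy β) := by
  have hpos : 0 < μ (smallBox β) := Measure.measure_pos_of_mem_nhds μ smallBox_mem_nhds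
  refine hpos.trans_le (not_lt.1 fun hlt => ?_)
  obtain ⟨V, hV, hVo, hVlt⟩ := Set.exists_isOpen_lt_of_lt _ _ hlt
  obtain ⟨W, hW, hRW⟩ := compact_open_separated_add_right isCompact_rauzy hVo hV
  obtain ⟨n, hn⟩ := exists_iterate_mulGen_image_subset hW
  have h1 := le_measure_rauzy_add μ n
  rw [mul_modulus_eq_one, one_pow, one_mul] at h1
  exact absurd (h1.trans (measure_mono ((Set.add_subset_add_left hn).trans hRW))) (not_le.2 hVlt)

end

section

variable {β : ℝ} [hβ : Fact (IsPisot β)]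

/-! ### The Perron eigenvector of the automaton -/

/-- An arrow is determined by its origin and its label, which is at most the quasi-greedy digit. -/
def arrowEquiv (β : ℝ) [Fact (IsPisot β)] :
    Arrow β ≃ Σ p : State β, Fin (qgDigit β p.val + 1) :=
  Equiv.ofBijective (fun e => ⟨e.1.1, e.1.2.1, Nat.lt_succ_of_le
      ((le_qgDigit_iff (beta_pos β) (e.1.1.val_pos (one_lt_beta β)) _).2
        ((edge_iff (one_lt_beta β) _ _ _).1 e.2).1)⟩) <| by
    constructor
    · rintro ⟨⟨p, a, q⟩, he⟩ ⟨⟨p', a', q'⟩, he'⟩ h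
      obtain ⟨rfl, h2⟩ := Sigma.mk.inj h
      obtain rfl : a = a' := congrArg Fin.val (eq_of_heq h2)
      obtain rfl : q = q' := he.unique he'
      rfl
    · rintro ⟨p, a, ha⟩
      obtain ⟨q, hq⟩ := exists_edge (one_lt_beta β) (p := p) (a := a)
        ((le_qgDigit_iff (beta_pos β) (p.val_pos (one_lt_beta β)) _).1 (Nat.le_of_lt_succ ha))
      exact ⟨⟨(p, a, q), hq⟩, rfl⟩

/-- Every digit but the largest leads to `1`, and the largest leads to `βu` minus the number of the
others. This is the eigenvector equation for the eigenvalue `β`. -/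
theorem sum_stateStep {u : ℝ} (hu : 0 < u) :
    ∑ a : Fin (qgDigit β u + 1), stateStep β u a = β * u := by
  rw [Fin.sum_univ_castSucc]
  have h : ∀ a : Fin (qgDigit β u), stateStep β u (a.castSucc : ℕ) = 1 :=
    fun a => stateStep_of_lt (beta_pos β) hu a.2
  simp only [h, Fin.val_last]
  rw [stateStep_qgDigit (beta_pos β) hu, qgMap_eq (beta_pos β) hu]
  simp

theorem sum_arrow [Fintype (Arrow β)] [Fintype (State β)] (r : State β → ENNReal) :
    ∑ e : Arrow β, ENNReal.ofReal e.1.2.2.val * r e.1.1 =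
      ENNReal.ofReal β * ∑ p : State β, ENNReal.ofReal p.val * r p := by
  have hb := one_lt_beta β
  rw [Finset.mul_sum]
  have h1 : ∀ e : Arrow β, ENNReal.ofReal e.1.2.2.val * r e.1.1 =
      (fun x : Σ p : State β, Fin (qgDigit β p.val + 1) =>
        ENNReal.ofReal (stateStep β x.1.val x.2) * r x.1) (arrowEquiv β e) := fun e => by
    rw [((edge_iff hb _ _ _).1 e.2).2]; rfl
  rw [Finset.sum_congr rfl fun e _ => h1 e, Equiv.sum_comp (arrowEquiv β) fun x :
    Σ p : State β, Fin (qgDigit β p.val + 1) =>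
      ENNReal.ofReal (stateStep β x.1.val x.2) * r x.1, Fintype.sum_sigma]
  refine Finset.sum_congr rfl fun p _ => ?_
  simp only
  rw [← Finset.sum_mul, ← ENNReal.ofReal_sum_of_nonneg, sum_stateStep (p.val_pos hb),
    ENNReal.ofReal_mul (beta_pos β).le, mul_assoc]
  intro a _
  exact (stateStep_pos_iff.2 ((le_qgDigit_iff (beta_pos β) (p.val_pos hb) _).1
    (Nat.le_of_lt_succ a.2))).le

/-! ### Disjointness in measure -/

/-- An overlap of two sets is counted twice in the sum; as everything is finite, it cancels to
measure zero. -/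
theorem aedisjoint_of_sum_le {α ι : Type*} [MeasurableSpace α] [Fintype ι] {μ : Measure α}
    {A : ι → Set α} (hA : ∀ i, MeasurableSet (A i)) (hfin : ∀ i, μ (A i) ≠ ⊤)
    (h : ∑ i, μ (A i) ≤ μ (⋃ i, A i)) : Pairwise fun i j => AEDisjoint μ (A i) (A j) := by
  classical
  intro i j hij
  have h1 : ⋃ k, A k ⊆ (A i ∪ A j) ∪ ⋃ k ∈ Finset.univ \ {i, j}, A k := by
    refine Set.iUnion_subset fun k x hx => ?_
    by_cases hk : k = i ∨ k = j
    · exact .inl (hk.elim (fun h => .inl (h ▸ hx)) fun h => .inr (h ▸ hx))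
    · exact .inr (Set.mem_iUnion₂.2 ⟨k, by simpa using hk, hx⟩)
  have h2 := (h.trans (measure_mono h1)).trans (measure_union_le _ _)
  have h3 := h2.trans (add_le_add_right (measure_biUnion_finset_le _ _) _)
  have h4 : ∑ k, μ (A k) = μ (A i) + μ (A j) + ∑ k ∈ Finset.univ \ {i, j}, μ (A k) := by
    rw [← Finset.sum_pair (f := fun k => μ (A k)) hij, add_comm, Finset.sum_sdiff (Finset.subset_univ _)]
  rw [h4] at h3
  have h5 := ENNReal.le_of_add_le_add_right
    (ENNReal.sum_ne_top.2 fun k _ => hfin k) h3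
  rw [← measure_union_add_inter _ (hA j)] at h5
  have h6 : μ (A i ∪ A j) ≠ ⊤ :=
    (measure_union_lt_top (hfin i).lt_top (hfin j).lt_top).ne
  have h7 : μ (A i ∪ A j) + μ (A i ∩ A j) ≤ μ (A i ∪ A j) + 0 := by rwa [add_zero]
  exact le_zero_iff.1 (ENNReal.le_of_add_le_add_left h6 h7)

theorem affineMap_image (a : ℕ) (S : Set (RepSpace β)) :
    affineMap β a '' S = canonicalEmbedding β (a : QBeta β) +ᵥ (mulGen β '' S) := by
  have h : affineMap β a = fun x => canonicalEmbedding β (a : QBeta β) +ᵥ mulGen β x :=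
    funext fun x => add_comm _ _
  rw [h, ← Set.image_vadd, Set.image_image]

theorem affineMap_injective (a : ℕ) : Function.Injective (affineMap β a) :=
  fun _ _ h => (mulGen β).injective (add_right_cancel h)

variable (μ : Measure (RepSpace β)) [μ.IsAddHaarMeasure]

theorem measure_affineMap_image (a : ℕ) (S : Set (RepSpace β)) :
    μ (affineMap β a '' S) = modulus β * μ S := by
  rw [affineMap_image, measure_vadd, measure_mulGen_image]

theorem isCompact_affineMap_image (a : ℕ) (s : State β) :
    IsCompact (affineMap β a '' rauzyPiece β s) := by
  rw [affineMap_image]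
  exact ((isCompact_rauzyPiece s).image (mulGen β).continuous).vadd _

theorem modulus_ne_zero : (modulus β : ENNReal) ≠ 0 := by
  intro h
  have := mul_modulus_eq_one (β := β)
  rw [h, mul_zero] at this
  exact zero_ne_one this

open Classical in
/-- The measures of the images that make up a piece add up to the measure of the piece, since the
measures of the pieces are controlled by the Perron eigenvector `State.val`. -/
theorem sum_measure_image_le [Fintype (Arrow β)] (s : State β) :
    ∑ e : {e : Arrow β // e.1.2.2 = s}, μ (affineMap β e.1.1.2.1 '' rauzyPiece β e.1.1.1) ≤
      μ (rauzyPiece β s) := by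
  have := Fintype.ofFinite (State β)
  have hb := one_lt_beta β
  set r : State β → ENNReal := fun p => μ (rauzyPiece β p)
  have hr : ∀ p, r p ≠ ⊤ := fun p => (isCompact_rauzyPiece p).measure_lt_top.ne
  set S : State β → ENNReal := fun s => ∑ e : {e : Arrow β // e.1.2.2 = s},
    μ (affineMap β e.1.1.2.1 '' rauzyPiece β e.1.1.1) with hS
  have hrS : ∀ s, r s ≤ S s := fun s => by
    change μ (rauzyPiece β s) ≤ _
    rw [rauzyPiece_eq]
    exact measure_iUnion_fintype_le _ _
  -- Exchanging the sums, the eigenvalue `β` cancels against the modulus `1 / β`.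
  have hsum : ∑ s, ENNReal.ofReal s.val * S s = ∑ s, ENNReal.ofReal s.val * r s := by
    have h1 : ∑ s, ENNReal.ofReal s.val * S s =
        ∑ e : Arrow β, ENNReal.ofReal e.1.2.2.val * (modulus β * r e.1.1) := by
      rw [← Fintype.sum_fiberwise (fun e : Arrow β => e.1.2.2)]
      refine Finset.sum_congr rfl fun s _ => ?_
      rw [hS, Finset.mul_sum]
      refine Finset.sum_congr rfl fun e _ => ?_
      rw [measure_affineMap_image, e.2]
    rw [h1, sum_arrow fun p => modulus β * r p]
    have h2 : ∀ p : State β, ENNReal.ofReal p.val * (modulus β * r p) =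
        modulus β * (ENNReal.ofReal p.val * r p) := fun p => by ring
    simp only [h2]
    rw [← Finset.mul_sum, ← mul_assoc, mul_modulus_eq_one, one_mul]
  have hSfin : ∀ s, S s ≠ ⊤ := fun s => ENNReal.sum_ne_top.2 fun e _ =>
    (isCompact_affineMap_image _ _).measure_lt_top.ne
  have hu : ENNReal.ofReal s.val ≠ 0 := (ENNReal.ofReal_pos.2 (s.val_pos hb)).ne'
  -- Since `r ≤ S` at each state and the totals with positive weights agree, no single term can be
  -- strict.
  rw [← Finset.add_sum_erase _ _ (Finset.mem_univ s),
    ← Finset.add_sum_erase _ (fun s => ENNReal.ofReal s.val * r s) (Finset.mem_univ s)] at hsum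
  have hle : ∑ t ∈ Finset.univ.erase s, ENNReal.ofReal t.val * r t ≤
      ∑ t ∈ Finset.univ.erase s, ENNReal.ofReal t.val * S t :=
    Finset.sum_le_sum fun t _ => mul_le_mul_right (hrS t) _
  have h3 := hsum.le.trans (add_le_add_right hle _)
  have h4 := ENNReal.le_of_add_le_add_right
    (ENNReal.sum_ne_top.2 fun t _ => ENNReal.mul_ne_top ENNReal.ofReal_ne_top (hSfin t)) h3
  exact (ENNReal.mul_le_mul_iff_right hu ENNReal.ofReal_ne_top).1 h4

theorem aedisjoint_image (s : State β) : Pairwise fun e e' : {e : Arrow β // e.1.2.2 = s} =>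
    AEDisjoint μ (affineMap β e.1.1.2.1 '' rauzyPiece β e.1.1.1)
      (affineMap β e'.1.1.2.1 '' rauzyPiece β e'.1.1.1) := by
  classical
  have := Fintype.ofFinite (Arrow β)
  refine aedisjoint_of_sum_le
    (A := fun e : {e : Arrow β // e.1.2.2 = s} => affineMap β e.1.1.2.1 '' rauzyPiece β e.1.1.1)
    (fun e => (isCompact_affineMap_image _ _).isClosed.measurableSet)
    (fun e => (isCompact_affineMap_image _ _).measure_lt_top.ne) ?_
  rw [← rauzyPiece_eq]
  exact sum_measure_image_le μ s

/-! ### Disjointness and positivity of the pieces -/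

variable (β) in
theorem exists_zeroStep : ∃ z : State β → State β, ∀ s, Edge β s 0 (z s) := by
  have hb := one_lt_beta β
  have h : ∀ s : State β, ∃ q, Edge β s 0 q := fun s =>
    exists_edge hb (by simpa using mul_pos (beta_pos β) (s.val_pos hb))
  exact ⟨fun s => (h s).choose, fun s => (h s).choose_spec⟩

/-- Reading enough zeros leads to the state `1`. -/
theorem exists_iterate_val_eq_one {z : State β → State β} (hz : ∀ s, Edge β s 0 (z s))
    (s : State β) : ∃ n, ∀ m, n ≤ m → (z^[m] s).val = 1 := by
  have hb := one_lt_beta β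
  -- Reading a zero multiplies the state by `β`, truncated at `1`.
  have h1 : ∀ m, min 1 (β ^ m * s.val) ≤ (z^[m] s).val := by
    intro m
    induction m with
    | zero => simp
    | succ m ih =>
      rw [Function.iterate_succ_apply', ((edge_iff hb _ _ _).1 (hz _)).2, stateStep, Nat.cast_zero,
        sub_zero]
      refine le_min (min_le_left _ _) ?_
      have h2 := mul_le_mul_of_nonneg_left ih (beta_pos β).le
      rcases min_cases 1 (β ^ m * s.val) with ⟨h, -⟩ | ⟨h, -⟩
      · rw [h] at h2
        exact (min_le_left _ _).trans (by linarith)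
      · rw [h] at h2
        exact (min_le_right _ _).trans (by rw [pow_succ']; linarith)
  obtain ⟨n, hn⟩ := pow_unbounded_of_one_lt (s.val)⁻¹ hb
  refine ⟨n, fun m hm => le_antisymm (State.val_le_one hb _) ((h1 m).trans' (le_min le_rfl ?_))⟩
  have h3 := pow_le_pow_right₀ hb.le hm
  have h4 := (inv_lt_iff_one_lt_mul₀ (s.val_pos hb)).1 hn
  exact h4.le.trans (mul_le_mul_of_nonneg_right h3 (s.val_pos hb).le)

theorem image_subset_rauzyPiece {p s : State β} {a : ℕ} (h : Edge β p a s) :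
    affineMap β a '' rauzyPiece β p ⊆ rauzyPiece β s := by
  rw [rauzyPiece_eq s]
  exact Set.subset_iUnion (fun e : {e : Arrow β // e.1.2.2 = s} =>
    affineMap β e.1.1.2.1 '' rauzyPiece β e.1.1.1) ⟨⟨(p, a, s), h⟩, rfl⟩

/-- When reading a zero merges the two states, the images of their pieces are different terms of one
set equation, so `aedisjoint_image` applies. Otherwise the images lie in the pieces of the next two
states. The affine map is injective with non-zero modulus, so the null overlap pulls back. -/
theorem aedisjoint_of_iterate_eq {z : State β → State β} (hz : ∀ s, Edge β s 0 (z s)) (n : ℕ)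
    {s t : State β} (hst : s ≠ t) (h : z^[n] s = z^[n] t) :
    AEDisjoint μ (rauzyPiece β s) (rauzyPiece β t) := by
  induction n generalizing s t with
  | zero => exact absurd h hst
  | succ n ih =>
    have h1 : AEDisjoint μ (affineMap β 0 '' rauzyPiece β s) (affineMap β 0 '' rauzyPiece β t) := by
      by_cases hzz : z s = z t
      · have he : Edge β t 0 (z s) := hzz ▸ hz t
        exact aedisjoint_image μ (z s) (i := ⟨⟨(s, 0, z s), hz s⟩, rfl⟩)
          (j := ⟨⟨(t, 0, z s), he⟩, rfl⟩) fun heq =>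
            hst (congrArg (fun e : {e : Arrow β // e.1.2.2 = z s} => e.1.1.1) heq)
      · exact (ih hzz h).mono (image_subset_rauzyPiece (hz s)) (image_subset_rauzyPiece (hz t))
    rw [AEDisjoint, ← Set.image_inter (affineMap_injective 0), measure_affineMap_image,
      mul_eq_zero] at h1
    exact h1.resolve_left modulus_ne_zero

theorem aedisjoint_rauzyPiece :
    Pairwise fun s t : State β => AEDisjoint μ (rauzyPiece β s) (rauzyPiece β t) := by
  intro s t hst
  obtain ⟨z, hz⟩ := exists_zeroStep β
  obtain ⟨n, hn⟩ := exists_iterate_val_eq_one hz s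
  obtain ⟨m, hm⟩ := exists_iterate_val_eq_one hz t
  refine aedisjoint_of_iterate_eq μ hz (max n m) hst (State.val_injective (one_lt_beta β) ?_)
  rw [hn _ (le_max_left _ _), hm _ (le_max_right _ _)]

theorem measure_rauzyPiece_pos_of_edge {p s : State β} {a : ℕ} (h : Edge β p a s)
    (hp : 0 < μ (rauzyPiece β p)) : 0 < μ (rauzyPiece β s) := by
  refine lt_of_lt_of_le ?_ (measure_mono (image_subset_rauzyPiece h))
  rw [measure_affineMap_image]
  exact ENNReal.mul_pos modulus_ne_zero hp.ne'

/-- Some piece is positive because the union is. Zeros lead from its state to `1`, quasi-greedy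
digits lead from `1` to every state, and arrows preserve positivity. -/
theorem measure_rauzyPiece_pos (s : State β) : 0 < μ (rauzyPiece β s) := by
  have hb := one_lt_beta β
  obtain ⟨z, hz⟩ := exists_zeroStep β
  obtain ⟨p, hp⟩ : ∃ p : State β, 0 < μ (rauzyPiece β p) := by
    by_contra! h
    have h1 := measure_rauzy_pos μ
    rw [rauzy_eq_iUnion, measure_iUnion_null fun p => le_zero_iff.1 (h p)] at h1
    exact lt_irrefl _ h1
  have hiter : ∀ n, 0 < μ (rauzyPiece β (z^[n] p)) := by
    intro n
    induction n with
    | zero => exact hp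
    | succ n ih =>
      rw [Function.iterate_succ_apply']
      exact measure_rauzyPiece_pos_of_edge μ (hz _) ih
  obtain ⟨n, hn⟩ := exists_iterate_val_eq_one hz p
  have key : ∀ k, ∀ q : State β, q.val = qgOrbit β k → 0 < μ (rauzyPiece β q) := by
    intro k
    induction k with
    | zero =>
      intro q hq
      have h1 : q = z^[n] p := State.val_injective hb (by rw [hq, hn n le_rfl, qgOrbit_zero])
      exact h1 ▸ hiter n
    | succ k ih =>
      intro q hq
      obtain ⟨q', hq'⟩ := State.exists_val_eq hb (u := qgOrbit β k) ⟨k, rfl⟩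
      refine measure_rauzyPiece_pos_of_edge μ (a := qgDigit β (qgOrbit β k)) ?_ (ih q' hq')
      rw [edge_iff hb, hq', hq, stateStep_qgDigit (beta_pos β) (qgOrbit_pos β k), qgOrbit_succ]
      exact ⟨(le_qgDigit_iff (beta_pos β) (qgOrbit_pos β k) _).1 le_rfl, rfl⟩
  obtain ⟨k, hk⟩ := s.val_mem hb
  exact key k s hk.symm

/-! ### The cylinders -/

variable (β) in
/-- Every Haar measure of `K_β × ℝ` is a multiple of a product measure. -/
theorem exists_eq_smul_prod (ν : Measure (RepSpace β × ℝ)) [ν.IsAddHaarMeasure] :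
    ∃ (μ : Measure (RepSpace β)) (c : NNReal), μ.IsAddHaarMeasure ∧ c ≠ 0 ∧
      ν = c • μ.prod (volume : Measure ℝ) := by
  let μ₁ : Measure (RepSpace β) := Measure.addHaar
  refine ⟨μ₁, _, inferInstance, ?_, Measure.isAddLeftInvariant_eq_smul ν (μ₁.prod volume)⟩
  exact (Measure.addHaarScalarFactor_pos_of_isAddHaarMeasure ν (μ₁.prod volume)).ne'

theorem measure_neg_rauzyPiece_pos (s : State β) : 0 < μ (-rauzyPiece β s) := by
  rw [Measure.measure_neg]
  exact measure_rauzyPiece_pos μ s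

theorem measure_rauzy₂_pos (ν : Measure (RepSpace β × ℝ)) [ν.IsAddHaarMeasure] :
    0 < ν (rauzy₂ β) := by
  have hb := one_lt_beta β
  obtain ⟨μ, c, hμ, hc, rfl⟩ := exists_eq_smul_prod β ν
  obtain ⟨s, -⟩ := State.exists_val_eq hb (one_mem_range β)
  rw [rauzy₂_eq_iUnion]
  refine lt_of_lt_of_le ?_ (measure_mono (Set.subset_iUnion _ s))
  rw [Measure.smul_apply, Measure.prod_prod, Real.volume_Icc, sub_zero]
  exact ENNReal.mul_pos (by simpa using hc) (mul_ne_zero (measure_neg_rauzyPiece_pos μ s).ne'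
    (ENNReal.ofReal_pos.2 (s.val_pos hb)).ne')

/-- The intervals all overlap at their lower ends; the disjointness comes entirely from the factor
in `K_β`. -/
theorem aedisjoint_cylinder (ν : Measure (RepSpace β × ℝ)) [ν.IsAddHaarMeasure] :
    Pairwise fun s t : State β => AEDisjoint ν ((-rauzyPiece β s) ×ˢ Set.Icc 0 s.val)
      ((-rauzyPiece β t) ×ˢ Set.Icc 0 t.val) := by
  intro s t hst
  obtain ⟨μ, c, hμ, hc, rfl⟩ := exists_eq_smul_prod β ν
  have h1 : μ (-(rauzyPiece β s ∩ rauzyPiece β t)) = 0 := by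
    rw [Measure.measure_neg]
    exact aedisjoint_rauzyPiece μ hst
  rw [AEDisjoint, Set.prod_inter_prod, ← Set.inter_neg, Measure.smul_apply, Measure.prod_prod, h1,
    zero_mul, smul_zero]

end

end BetaShift

end

/-- In the graph-directed structure the arrows are reversed: an edge starts at the end state of the
arrow, as the piece there is the one being subdivided. -/
theorem mainTheorem2 (β : ℝ) [hβ : Fact (IsPisot β)] :
    Finite (State β) ∧ Nat.card (State β) = numPieces β ∧
    (∀ (μ : Measure (RepSpace β)) [μ.IsAddHaarMeasure],
      IsGraphDirectedSelfAffine β μ (fun e : Arrow β => e.1.2.2) (fun e : Arrow β => e.1.1)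
        (fun e : Arrow β => affineMap β e.1.2.1) (rauzyPiece β) (rauzy β) ∧
      0 < μ (rauzy β) ∧ ∀ s : State β, 0 < μ (rauzyPiece β s)) ∧
    (∀ (ν : Measure (RepSpace β × ℝ)) [ν.IsAddHaarMeasure], 0 < ν (rauzy₂ β)) ∧
    ∃ a b : State β → ℝ, (∀ s, a s < b s) ∧
      rauzy₂ β = ⋃ s : State β, (-rauzyPiece β s) ×ˢ Set.Icc (a s) (b s) ∧
      ∀ (ν : Measure (RepSpace β × ℝ)) [ν.IsAddHaarMeasure],
        Pairwise fun s t : State β => AEDisjoint ν ((-rauzyPiece β s) ×ˢ Set.Icc (a s) (b s))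
          ((-rauzyPiece β t) ×ˢ Set.Icc (a t) (b t)) := by
  refine ⟨inferInstance, card_state, fun μ _ => ⟨?_, measure_rauzy_pos μ, measure_rauzyPiece_pos μ⟩,
    fun ν _ => measure_rauzy₂_pos ν, fun _ => 0, State.val,
    fun s => s.val_pos (one_lt_beta β), rauzy₂_eq_iUnion, fun ν _ => aedisjoint_cylinder ν⟩
  exact
    { finite_vertices := inferInstance
      finite_edges := inferInstance
      contraction := fun e => isAffineContraction_affineMap _
      isCompact := isCompact_rauzyPiece
      nonempty := fun s => nonempty_of_measure_ne_zero (measure_rauzyPiece_pos μ s).ne'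
      iUnion_eq := rauzy_eq_iUnion
      piece_eq := rauzyPiece_eq
      aedisjoint_image := aedisjoint_image μ
      aedisjoint_piece := aedisjoint_rauzyPiece μ }
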